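/- **Setting.** Let $G=(V,E)$ be a finite undirected graph on $n$ nodes with integer edge weights $\omega:E\to\mathbb{N}$, $\omega(e)\ge 1$ (the unweighted case is $\omega\equiv 1$), and let $\omega(u,v)$ denote weighted distance. Every node has a unique ID in $\{0,\dots,n^{c}\}$ for a constant $c$. Let $\emptyset\ne S\subseteq V$ and $k\in\mathbb{N}$; initially a node knows its own ID, the IDs of its neighbors, the weights of its edges, whether it is in $S$, and the numbers $|S|$ and $k$. In the CONGEST model computation proceeds in synchronous rounds, and per round each node may send one short message to each neighbor. For $r\in S$ the directed leveled graph (DLG) $\mathcal{L}_r$ of depth $k$ rooted at $r$ has as level $i\le k$ the set of nodes $v$ with $\omega(r,v)=i$, and an arc from $u$ to $v$ (making $u$ a parent of $v$ and $v$ a child of $u$) for each edge $\{u,v\}\in E$ with $u$ on some level $i$, $v$ on level $i+\omega(\{u,v\})$ and $i+\omega(\{u,v\})\le k$. **Algorithm DLGcomp.** Suppose first $\omega\equiv1$. Each node $u$ keeps a set $L$ of roots it has heard of, for each neighbor $u_i$ a set $L_i$ of roots still to be announced to $u_i$, a queue $L_{delay}$, and for each root $r$ a distance $\omega[r]$ and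 a list of parents with arrival times $\tau$. At the start everything is empty and $\omega[r]=\infty$, except that for $u\in S$ we have $L=L_i=\{u\}$ and $\omega[u]=0$. In each of the rounds $t=0,\dots,|S|+k$, $u$ does the following. 1. For each neighbor $u_i$, $u$ lets $l_i=\min (L_i\setminus L_{delay})$ ($\infty$ if this is empty), sends $(l_i,\omega[l_i]+1)$ to $u_i$ if $l_i<\infty$, and receives $(r_i,\omega_i)$ from $u_i$ ($r_i=\infty$ if nothing arrives). 2. Let $R=\{r_i: r_i<l_i\}\setminus L$ and $s=\min L_{delay}$ (with $\min\emptyset=\infty$). If $s\le\min R$ and $s<\infty$, then $s$ is removed from $L_{delay}$. 3. The neighbors $u_i$ are processed one after the other. If $r_i\ge l_i$, then $l_i$ is removed from $L_i$. If $r_i<l_i$ and $\omega_i\le\omega[r_i]$, then: (a) if $\omega_i\le k$, $u_i$ is recorded as a parent of $u$ for the root $r_i$, with arrival time $t$; (b) if $r_i\in L$, $r_i$ is removed from $L_i$, and otherwise $\omega[r_i]:=\omega_i$, $r_i$ is added to $L$ and to all $L_j$ with $j\neq i$, and it is added to $L_{delay}$ if $\min R<r_i$ or $s<r_i$. If $r_i<l_i$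 and $\omega_i>\omega[r_i]$, nothing happens. For general $\omega$, an edge of weight $w$ acts as a path of $w$ links of length one, whose $w-1$ inner relays run the same program as nodes outside $S$ and are simulated by both ends of the edge; only the messages that the two ends put on the path are exchanged over the edge. **Algorithm DLGagr.** It gets the variables left by DLGcomp and an aggregation algorithm $\mathcal{A}'$: for each node and root an initial value, an update of this value that is executed when a message from a child arrives, and a message to the parents that is computed from the current value. In each round $t=0,\dots,|S|+k$ every node sends, for each root $r$ and each parent $h$ recorded for $r$ with arrival time $\tau=|S|+k-t$, the pair of $r$ and its current message for $r$ to $h$; then it executes the update for every message received. **Theorem.** There is an absolute constant $C$ such that in every such network: 1. DLGcomp stops after at most $C(|S|+k)$ rounds, and then for every $r\in S$ the levels and parents stored at the nodes form exactly the DLG $\mathcal{L}_r$ of depth $k$. Per round and direction at most one message is sent over an edge, and if all weights are at most $W$, it has at most $B(\log n+\log W)$ bits, where $B$ depends only on $c$. 2. For every aggregation algorithm $\mathcal{A}'$, DLGagr, run on the result of DLGcomp, stops after at most $C(|S|+k)$ rounds, and then for every $r\in S$ information has been aggregated bottom-up through $\mathcal{L}_r$: the final value of each node $u$ for $r$ arises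 from its initial value by processing, for each child $c$ of $u$ in $\mathcal{L}_r$ exactly once and in some order, the message that $\mathcal{A}'$ computes from the final value of $c$ for $r$. Per round and direction at most one message is sent over an edge, and if the messages that $\mathcal{A}'$ computes from the final values have at most $b$ bits, it has at most $B\log n+b$ bits. -/

import Mathlib

/-! ### Weighted distances and directed leveled graphs -/

section Graphs

variable {V : Type*}

/-- The weighted distance: the least weight of a walk from `u` to `v`, and `⊤` if there is none. -/
noncomputable def wdist (G : SimpleGraph V) (ω : Sym2 V → ℕ) (u v : V) : ℕ∞ :=
  ⨅ p : G.Walk u v, (((p.edges.map ω).sum : ℕ) : ℕ∞)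

/-- Data of a leveled graph: its levels and its arcs. -/
@[ext]
structure LeveledGraph (V : Type*) where
  /-- `level i` is the set of nodes on level `i`. -/
  level : ℕ → Set V
  /-- `arc u v`: there is an arc directed from `u` to `v` (`u` is a parent of `v`). -/
  arc : V → V → Prop

/-- The directed leveled graph of depth `k` rooted at `r`: level `i ≤ k` consists of the nodes at
weighted distance `i` from `r`, and an edge `{u, v}` is directed from `u` to `v` if `u` is on some
level `i` and `v` is on level `i + ω {u, v}`. -/
def directedLeveledGraph (G : SimpleGraph V) (ω : Sym2 V → ℕ) (k : ℕ) (r : V) :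
    LeveledGraph V where
  level i := {v | i ≤ k ∧ wdist G ω r v = i}
  arc u v := G.Adj u v ∧ ∃ i : ℕ, wdist G ω r u = i ∧ i + ω s(u, v) ≤ k ∧
    wdist G ω r v = ((i + ω s(u, v) : ℕ) : ℕ∞)

end Graphs

/-! ### Synchronous message passing -/

/-- A synchronous distributed algorithm, as the program that every node runs. A node sees only its
local input (of type `I`), the round number, its own state (of type `σ`) and the messages (of type
`μ`) that its neighbors send to it. `send i t s v` lists the messages that are sent to the neighbor
`v` in round `t`; the CONGEST model asks that these are at most one short message. -/
structure SyncAlgorithm (V I σ μ : Type*) where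
  /-- The state before the first round. -/
  start : I → σ
  /-- Local input, round, state and receiving neighbor to the messages sent. -/
  send : I → ℕ → σ → V → List μ
  /-- Local input, round, state and inbox (indexed by the sending neighbor) to the new state. -/
  recv : I → ℕ → σ → (V → List μ) → σ
  /-- The number of rounds after which the node stops. -/
  rounds : I → ℕ

namespace SyncAlgorithm

variable {V I σ μ : Type*} (A : SyncAlgorithm V I σ μ)

/-- The states of all nodes at the beginning of round `t`. -/
def stateAt (G : SimpleGraph V) [DecidableRel G.Adj] (input : V → I) : ℕ → V → σ
  | 0 => fun u => A.start (input u)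
  | t + 1 =>
    let prev := stateAt G input t
    fun u => A.recv (input u) t (prev u)
      (fun v => if G.Adj v u then A.send (input v) t (prev v) u else [])

/-- The state of a node when it stops. -/
def final (G : SimpleGraph V) [DecidableRel G.Adj] (input : V → I) (u : V) : σ :=
  A.stateAt G input (A.rounds (input u)) u

/-- In every round every node sends at most one message over each of its edges, and that message
has at most `b` bits when `bits` measures the length of messages. -/
def RespectsBandwidth (G : SimpleGraph V) [DecidableRel G.Adj] (input : V → I) (bits : μ → ℕ)
    (b : ℕ) : Prop :=
  ∀ u v, G.Adj u v → ∀ t < A.rounds (input u),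
    (A.send (input u) t (A.stateAt G input t u) v).length ≤ 1 ∧
      ∀ m ∈ A.send (input u) t (A.stateAt G input t u) v, bits m ≤ b

end SyncAlgorithm

/-- What a node knows at the beginning: its name, its neighbors, the weights of its edges, whether
it is one of the roots, the number of roots and the depth. Names are compared by the order of `V`,
which is the order of the IDs. -/
structure LocalView (V : Type*) where
  self : V
  nbrs : Finset V
  weight : V → ℕ
  isRoot : Bool
  numRoots : ℕ
  depth : ℕ

/-- The local views in the network `G` with weights `ω`, set of roots `S` and depth `k`. -/
def localView {V : Type*} [Fintype V] [DecidableEq V] (G : SimpleGraph V) [DecidableRel G.Adj]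
    (ω : Sym2 V → ℕ) (S : Finset V) (k : ℕ) (u : V) : LocalView V where
  self := u
  nbrs := G.neighborFinset u
  weight v := if G.Adj u v then ω s(u, v) else 0
  isRoot := decide (u ∈ S)
  numRoots := S.card
  depth := k

/-! ### The node program of DLGcomp

The program is written for nodes whose incident links are labelled by a type `P`, because it is run
by the nodes of the network and also by the relays that simulate edge weights. Names of roots are
of type `V`, and `⊤ : WithTop V` stands for "no message". -/

/-- An `r`-message: the name of the root `r` and the distance from `r` to the receiver. -/
abbrev DLGMessage (V : Type*) := V × ℕ

/-- The variables of the program: the set `L` of roots heard of, the sets `L_i` of roots still to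
be announced over link `i`, the delay queue, the distances `ω[r]`, and for each root the list of
all pairs `(parent_in_T[i], τ[i])` for `i = 1, …, sp`, that is, the parents with the times at which
their messages came in. -/
structure DLGState (V P : Type*) where
  L : Finset V
  Lp : P → Finset V
  delay : Finset V
  dist : V → ℕ∞
  parents : V → List (P × ℕ)

namespace DLGState

variable {V P : Type*} [LinearOrder V] [DecidableEq P]

/-- The initial state of a node that is no root. -/
def idle : DLGState V P := ⟨∅, fun _ => ∅, ∅, fun _ => ⊤, fun _ => []⟩

/-- The initial state of the root `u`. -/
def root (u : V) : DLGState V P :=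
  ⟨{u}, fun _ => {u}, ∅, fun r => if r = u then 0 else ⊤, fun _ => []⟩

/-- The value `l_i`: the smallest root in `L_i` that is not delayed, `⊤` if there is none. -/
def next (s : DLGState V P) (i : P) : WithTop V := (s.Lp i \ s.delay).min

/-- The message that is sent over link `i`: the name `l_i` and the distance of the receiver along a
link of length one. (All distances of roots in `L` are finite.) -/
def outgoing (s : DLGState V P) (i : P) : Option (DLGMessage V) :=
  match s.next i with
  | none => none
  | some l => some (l, (s.dist l).toNat + 1)

/-- The root named in a possible message. -/
def rootOf : Option (DLGMessage V) → WithTop V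
  | none => ⊤
  | some m => (m.1 : WithTop V)

/-- The body of the loop that processes what came in over link `i` in round `t`. Here `l` are the
values `l_i` of this round, `inc` the incoming messages, `minR` is `min R` and `q` is the least
element of the delay queue at the beginning of the round. -/
def process (k t : ℕ) (l : P → WithTop V) (inc : P → Option (DLGMessage V)) (minR q : WithTop V)
    (s : DLGState V P) (i : P) : DLGState V P :=
  if rootOf (inc i) < l i then
    match inc i with
    | none => s
    | some (r, d) =>
      if (d : ℕ∞) ≤ s.dist r then
        let s' : DLGState V P :=
          if d ≤ k then
            { s with parents := Function.update s.parents r (s.parents r ++ [(i, t)]) }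
          else s
        if r ∉ s.L then
          { s' with
            dist := Function.update s.dist r d
            L := insert r s.L
            Lp := fun j => if j = i then s.Lp j else insert r (s.Lp j)
            delay := if minR < r ∨ q < r then insert r s.delay else s.delay }
        else
          { s' with Lp := Function.update s.Lp i ((s.Lp i).erase r) }
      else s
  else
    { s with Lp := Function.update s.Lp i ((s.Lp i).filter (fun v => (v : WithTop V) ≠ l i)) }

/-- One round: `links` lists the links in the order in which they are processed, `inc` is the inbox
of round `t`. -/
def round (k t : ℕ) (links : List P) (inc : P → Option (DLGMessage V)) (s : DLGState V P) :
    DLGState V P :=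
  let l : P → WithTop V := s.next
  let R : Finset V :=
    (links.filterMap (fun i =>
      if rootOf (inc i) < l i then (inc i).map Prod.fst else none)).toFinset \ s.L
  let q : WithTop V := s.delay.min
  let s₁ : DLGState V P :=
    if q ≤ R.min ∧ q < ⊤ then
      { s with delay := s.delay.filter (fun v => (v : WithTop V) ≠ q) }
    else s
  links.foldl (process k t l inc R.min q) s₁

end DLGState

/-! ### DLGcomp on a weighted network

A message is delayed on an edge according to the weight of the edge: an edge of weight `w` acts as
a path of `w` links of length one, with `w - 1` relays in between. The relays run the program of a
node that is no root; both ends of the edge keep a copy of their states, and the only messages that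
are exchanged over the edge are those that the two ends put on the path. For weight one there is no
relay, and an end receives directly what the other end sends. -/

/-- The state of a node in DLGcomp: its own variables, and for each neighbor `v` and each position
`1 ≤ j < w` the state of the `j`-th relay on the edge to `v`. Positions are counted from the end
with the lower ID. The link `false` of a relay leads to the lower end, `true` to the higher end. -/
structure DLGcompState (V : Type*) where
  core : DLGState V V
  relay : V → ℕ → DLGState V Bool

namespace DLGcompState

variable {V : Type*} [LinearOrder V]

/-- What the relay at position `j` on the path of length `w` gets over its two links, when `lo` and
`hi` are the messages put on the path by the lower and the higher end. -/
def relayInbox (rel : ℕ → DLGState V Bool) (w : ℕ) (lo hi : Option (DLGMessage V)) (j : ℕ) :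
    Bool → Option (DLGMessage V)
  | false => if j = 1 then lo else (rel (j - 1)).outgoing true
  | true => if j + 1 = w then hi else (rel (j + 1)).outgoing false

/-- What the node `u` gets from the direction of its neighbor `v`, over a path of length `w`, when
`inc` is the message put on the path by `v`. -/
def coreInbox (u v : V) (w : ℕ) (rel : ℕ → DLGState V Bool) (inc : Option (DLGMessage V)) :
    Option (DLGMessage V) :=
  if w ≤ 1 then inc
  else if u < v then (rel 1).outgoing false
  else (rel (w - 1)).outgoing true

end DLGcompState

/-- The algorithm DLGcomp. -/
def DLGcomp (V : Type*) [LinearOrder V] :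
    SyncAlgorithm V (LocalView V) (DLGcompState V) (DLGMessage V) where
  start i :=
    { core := if i.isRoot then DLGState.root i.self else DLGState.idle
      relay := fun _ _ => DLGState.idle }
  send _ _ s v := (s.core.outgoing v).toList
  recv i t s inbox :=
    { core := s.core.round i.depth t (i.nbrs.sort (· ≤ ·)) (fun v =>
        DLGcompState.coreInbox i.self v (i.weight v) (s.relay v) (inbox v).head?)
      relay := fun v j =>
        let mine := s.core.outgoing v
        let other := (inbox v).head?
        let lo := if i.self < v then mine else other
        let hi := if i.self < v then other else mine
        (s.relay v j).round i.depth t [false, true]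
          (DLGcompState.relayInbox (s.relay v) (i.weight v) lo hi j) }
  rounds i := i.numRoots + i.depth + 1

/-- The leveled graph for the root `r` that is stored in a distributed way in the variables of the
nodes: every node stores its level and its parents. -/
def storedLeveledGraph {V : Type*} (k : ℕ) (st : V → DLGcompState V) (r : V) : LeveledGraph V where
  level i := {v | i ≤ k ∧ (st v).core.dist r = i}
  arc u v := ∃ τ : ℕ, (u, τ) ∈ (st v).core.parents r

/-! ### DLGagr -/

/-- An aggregation algorithm, run by the nodes during DLGagr: for each node and each root a
variable of type `β`, the computation executed when a message of a child comes in, and the message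
(of type `M`) for the parents. It may do different things at different nodes and for different
roots. -/
structure Aggregator (V β M : Type*) where
  /-- Node and root to the initial value. -/
  start : V → V → β
  /-- Node, root, child, message of the child and old value to the new value. -/
  step : V → V → V → M → β → β
  /-- Node, root and value to the message for the parents. -/
  out : V → V → β → M

/-- The local input of DLGagr: the local view and the variables left by DLGcomp. -/
structure DLGagrInput (V : Type*) where
  view : LocalView V
  comp : DLGcompState V

/-- The algorithm DLGagr: the schedule stored by DLGcomp is used in reverse order. The state
consists of the values for all roots. -/
def DLGagr {V β M : Type*} [LinearOrder V] (agg : Aggregator V β M) :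
    SyncAlgorithm V (DLGagrInput V) (V → β) (V × M) where
  start i := agg.start i.view.self
  send i t val v :=
    (i.comp.core.L.sort (· ≤ ·)).flatMap fun r =>
      ((i.comp.core.parents r).filter fun p =>
        decide (p.1 = v ∧ t + p.2 = i.view.numRoots + i.view.depth)).map
          fun _ => (r, agg.out i.view.self r (val r))
  recv i _ val inbox :=
    (i.view.nbrs.sort (· ≤ ·)).foldl (fun val' v =>
      (inbox v).foldl (fun val'' m =>
        Function.update val'' m.1 (agg.step i.view.self m.1 v m.2 (val'' m.1))) val') val
  rounds i := i.view.numRoots + i.view.depth + 1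

/-- The values `val u` are the result of the bottom-up aggregation through the leveled graph `D`
for the root `r`: the value of each node results from its initial value by processing, for each of
its children exactly once and in some order, the message computed from the child's own result. -/
def IsBottomUpAggregate {V β M : Type*} (agg : Aggregator V β M) (D : LeveledGraph V) (r : V)
    (val : V → β) : Prop :=
  ∀ u, ∃ children : List V, children.Nodup ∧ (∀ c, c ∈ children ↔ D.arc u c) ∧
    val u = children.foldl (fun b c => agg.step u r c (agg.out c r (val c)) b) (agg.start u r)

/-!
Write `d r` for the distance of a node from the root `r`, and place the roots one after the other in
increasing order, `r` occupying the `d r`-th time slot that is still free. This slot is the round in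
which the node releases `r` from its delay queue. A link carries `r` in the slot that the minimum of
the distances at its two ends yields in the same way.

For two distance functions that differ by at most one, the free slots that remain after each step
interleave. Hence a root crosses a link not before it is released at a parent and strictly before it
is released at the child, and every slot in between is used by a smaller root. This is what the
greedy queues of DLGcomp produce, so the execution is known exactly: in round `t` a link carries the
root whose slot is `t`. Since the relays on an edge are nodes at the intermediate distances, the
weighted case needs nothing new.

Distinct roots cross a link in distinct rounds, and arrival times increase along the arcs of a
leveled graph. So in the reversed schedule of DLGagr no two messages collide, and every node has
heard all its children before it sends its own value.
-/

/-! ### Slots -/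

section Slots

/-- The `n`-th natural number different from `a`. -/
def skipOver (a : ℕ∞) (n : ℕ) : ℕ := if (n : ℕ∞) < a then n else n + 1

theorem skipOver_strictMono (a : ℕ∞) : StrictMono (skipOver a) := by
  intro m n h
  cases a <;> simp only [skipOver, ENat.natCast_lt_top, Nat.cast_lt] <;> split_ifs <;> omega

theorem skipOver_le_skipOver {a b : ℕ∞} (h : b ≤ a) (n : ℕ) : skipOver a n ≤ skipOver b n := by
  by_cases hb : (n : ℕ∞) < b
  · simp only [skipOver, hb, hb.trans_le h, if_true, le_refl]
  · simp only [skipOver, hb, if_false]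
    split_ifs <;> omega

theorem skipOver_lt_skipOver_add_one {a b : ℕ∞} (h : a ≤ b + 1) (n : ℕ) :
    skipOver b n < skipOver a (n + 1) := by
  by_cases hb : (n : ℕ∞) < b
  · simp only [skipOver, hb, if_true]
    split_ifs <;> omega
  · have ha : ¬ ((n + 1 : ℕ) : ℕ∞) < a := by
      push_cast
      exact not_lt.mpr (h.trans (by gcongr; exact not_lt.mp hb))
    simp only [skipOver, hb, ha, if_false]
    omega

theorem natCast_skipOver_ne (a : ℕ∞) (n : ℕ) : (skipOver a n : ℕ∞) ≠ a := by
  unfold skipOver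
  split_ifs with h
  · exact h.ne
  · exact ((not_lt.mp h).trans_lt (Nat.cast_lt.mpr n.lt_succ_self)).ne'

theorem exists_skipOver_eq {a : ℕ∞} {m : ℕ} (h : (m : ℕ∞) ≠ a) : ∃ n, skipOver a n = m := by
  rcases lt_or_gt_of_ne h with h | h
  · exact ⟨m, if_pos h⟩
  · refine ⟨m - 1, ?_⟩
    cases a <;> simp only [skipOver, not_top_lt, Nat.cast_lt] at *
    split_ifs <;> omega

variable {V : Type*}

/-- The `n`-th time slot that is left free when the elements of the list are placed one after the
other, starting at the end of the list, and each `r` occupies the `d r`-th slot free by then. -/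
def freeSlot (d : V → ℕ∞) : List V → ℕ → ℕ
  | [], n => n
  | r :: l, n => freeSlot d l (skipOver (d r) n)

theorem freeSlot_strictMono (d : V → ℕ∞) : ∀ l : List V, StrictMono (freeSlot d l)
  | [] => strictMono_id
  | r :: l => (freeSlot_strictMono d l).comp (skipOver_strictMono (d r))

theorem freeSlot_le_freeSlot {d e : V → ℕ∞} (h : e ≤ d) (l : List V) (n : ℕ) :
    freeSlot d l n ≤ freeSlot e l n := by
  induction l generalizing n with
  | nil => exact le_rfl
  | cons r l ih =>
    exact (ih _).trans ((freeSlot_strictMono e l).monotone (skipOver_le_skipOver (h r) n))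

theorem freeSlot_lt_freeSlot_add_one {d e : V → ℕ∞} (h : d ≤ e + 1) (l : List V) (n : ℕ) :
    freeSlot e l n < freeSlot d l (n + 1) := by
  induction l generalizing n with
  | nil => exact n.lt_succ_self
  | cons r l ih =>
    exact (ih _).trans_le
      ((freeSlot_strictMono d l).monotone (skipOver_lt_skipOver_add_one (h r) n))

theorem freeSlot_le (d : V → ℕ∞) (l : List V) (n : ℕ) :
    freeSlot d l n ≤ n + (l.filter (fun r => d r ≠ ⊤)).length := by
  induction l generalizing n with
  | nil => exact le_rfl
  | cons r l ih =>
    refine (ih _).trans ?_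
    by_cases hr : d r = ⊤
    · simp [hr, skipOver]
    · have : skipOver (d r) n ≤ n + 1 := by unfold skipOver; split_ifs <;> omega
      simp only [ne_eq, hr, not_false_eq_true, decide_true, List.filter_cons_of_pos,
        List.length_cons]
      omega

theorem freeSlot_zero {d : V → ℕ∞} {l : List V} (h : ∀ r ∈ l, d r ≠ 0) : freeSlot d l 0 = 0 := by
  induction l with
  | nil => rfl
  | cons r l ih =>
    obtain ⟨hr, hl⟩ := List.forall_mem_cons.mp h
    simpa [freeSlot, skipOver, pos_iff_ne_zero.mpr hr] using ih hl

variable [LinearOrder V]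

theorem filter_lt_of_pairwise {a : V} {l : List V} (h : (a :: l).Pairwise (· > ·)) :
    (a :: l).filter (· < a) = l ∧
      ∀ r ∈ l, (a :: l).filter (· < r) = l.filter (· < r) := by
  rw [List.pairwise_cons] at h
  exact ⟨by simpa using h.1, fun r hr => by simp [(h.1 r hr).le]⟩

theorem exists_freeSlot_eq_or_occupied (d : V → ℕ∞) {l : List V} (hl : l.Pairwise (· > ·)) (t : ℕ) :
    (∃ n, freeSlot d l n = t) ∨
      ∃ r ∈ l, d r ≠ ⊤ ∧ freeSlot d (l.filter (· < r)) (d r).toNat = t := by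
  induction l with
  | nil => exact Or.inl ⟨t, rfl⟩
  | cons a l ih =>
    obtain ⟨filter_head, filter_tail⟩ := filter_lt_of_pairwise hl
    rcases ih hl.of_cons with ⟨m, hm⟩ | ⟨r, hr, hd, ht⟩
    · by_cases ha : (m : ℕ∞) = d a
      · refine Or.inr ⟨a, List.mem_cons_self, by simp [← ha], ?_⟩
        rwa [filter_head, ← ha, ENat.toNat_natCast]
      · obtain ⟨n, rfl⟩ := exists_skipOver_eq ha
        exact Or.inl ⟨n, hm⟩
    · exact Or.inr ⟨r, List.mem_cons_of_mem a hr, hd, by rwa [filter_tail r hr]⟩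

theorem freeSlot_ne_occupied (d : V → ℕ∞) {l : List V} (hl : l.Pairwise (· > ·)) {r : V}
    (hr : r ∈ l) (hd : d r ≠ ⊤) (n : ℕ) :
    freeSlot d l n ≠ freeSlot d (l.filter (· < r)) (d r).toNat := by
  induction l generalizing n with
  | nil => simp at hr
  | cons a l ih =>
    obtain ⟨filter_head, filter_tail⟩ := filter_lt_of_pairwise hl
    rcases List.mem_cons.mp hr with rfl | hr
    · rw [filter_head]
      intro h
      apply natCast_skipOver_ne (d r) n
      rw [(freeSlot_strictMono d l).injective h, ENat.natCast_toNat hd]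
    · rw [filter_tail r hr]
      exact ih hl.of_cons hr _

variable [Fintype V]

/-- All smaller names, in decreasing order. -/
def namesBelow (r : V) : List V := ((Finset.univ : Finset V).sort (· ≥ ·)).filter (· < r)

theorem mem_namesBelow {r s : V} : s ∈ namesBelow r ↔ s < r := by simp [namesBelow]

theorem namesBelow_pairwise (r : V) : (namesBelow r).Pairwise (· > ·) :=
  (Finset.sortedGT_sort _).pairwise.filter _

theorem namesBelow_filter {r s : V} (h : s < r) :
    (namesBelow r).filter (· < s) = namesBelow s := by
  rw [namesBelow, namesBelow, List.filter_filter]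
  exact List.filter_congr fun x _ => by simpa using fun hx => hx.trans h

/-- The time slot of `r` when names are placed in increasing order and each `s` occupies the
`d s`-th free slot; a junk value if `d r = ⊤`, in which case `r` occupies no slot. -/
def slot (d : V → ℕ∞) (r : V) : ℕ := freeSlot d (namesBelow r) (d r).toNat

theorem slot_injOn (d : V → ℕ∞) : Set.InjOn (slot d) {r | d r ≠ ⊤} := by
  have slot_ne {r s : V} (hr : d r ≠ ⊤) (hrs : r < s) : slot d s ≠ slot d r := by
    have := freeSlot_ne_occupied d (namesBelow_pairwise s) (mem_namesBelow.mpr hrs) hr (d s).toNat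
    rwa [namesBelow_filter hrs] at this
  intro r hr s hs h
  rcases lt_trichotomy r s with hrs | hrs | hrs
  · exact absurd h.symm (slot_ne hr hrs)
  · exact hrs
  · exact absurd h (slot_ne hs hrs)

theorem exists_slot_eq_of_forall_ne {d : V → ℕ∞} {r : V} {t : ℕ}
    (h : ∀ n, freeSlot d (namesBelow r) n ≠ t) : ∃ s < r, d s ≠ ⊤ ∧ slot d s = t := by
  rcases exists_freeSlot_eq_or_occupied d (namesBelow_pairwise r) t with ⟨n, hn⟩ | ⟨s, hs, hd, ht⟩
  · exact absurd hn (h n)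
  · have hs' := mem_namesBelow.mp hs
    rw [namesBelow_filter hs'] at ht
    exact ⟨s, hs', hd, ht⟩

theorem slot_eq_zero {d : V → ℕ∞} {r : V} (hr : d r = 0) (h : ∀ s < r, d s ≠ 0) :
    slot d r = 0 := by
  rw [slot, hr]
  exact freeSlot_zero fun s hs => h s (mem_namesBelow.mp hs)

theorem slot_le {d : V → ℕ∞} {S : Finset V} (h : ∀ s, d s ≠ ⊤ → s ∈ S) (r : V) :
    slot d r ≤ (d r).toNat + S.card := by
  refine (freeSlot_le d _ _).trans (Nat.add_le_add_left ?_ _)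
  have hn : ((namesBelow r).filter (fun s => d s ≠ ⊤)).Nodup :=
    ((namesBelow_pairwise r).imp fun h => h.ne').filter _
  rw [← List.toFinset_card_of_nodup hn]
  refine Finset.card_le_card fun s hs => h s ?_
  simpa using (List.mem_filter.mp (List.mem_toFinset.mp hs)).2

theorem slot_le_slot_of_eq {d e : V → ℕ∞} (h : e ≤ d) {r : V} (hr : e r = d r) :
    slot d r ≤ slot e r := by
  rw [slot, slot, hr]
  exact freeSlot_le_freeSlot h _ _

theorem exists_slot_eq_of_eq {d e : V → ℕ∞} (h : d ≤ e + 1) {r : V} (hr : e r = d r) {t : ℕ}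
    (h₁ : slot d r ≤ t) (h₂ : t < slot e r) : ∃ s < r, e s ≠ ⊤ ∧ slot e s = t := by
  refine exists_slot_eq_of_forall_ne ?_
  rintro n rfl
  rw [slot] at h₁ h₂
  rw [hr] at h₂
  have h₃ := (freeSlot_strictMono e _).lt_iff_lt.mp h₂
  have h₄ := (freeSlot_strictMono d _).lt_iff_lt.mp
    (h₁.trans_lt (freeSlot_lt_freeSlot_add_one h (namesBelow r) n))
  omega

theorem slot_lt_slot_of_add_one_eq {d e : V → ℕ∞} (h : d ≤ e + 1) {r : V} (hr : e r + 1 = d r)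
    (he : e r ≠ ⊤) : slot e r < slot d r := by
  rw [slot, slot, ← hr, ENat.toNat_add he ENat.one_ne_top]
  exact freeSlot_lt_freeSlot_add_one h _ _

theorem exists_slot_eq_of_add_one_eq {d e : V → ℕ∞} (h : e ≤ d) {r : V} (hr : e r + 1 = d r)
    (he : e r ≠ ⊤) {t : ℕ} (h₁ : slot e r < t) (h₂ : t < slot d r) :
    ∃ s < r, d s ≠ ⊤ ∧ slot d s = t := by
  refine exists_slot_eq_of_forall_ne ?_
  rintro n rfl
  rw [slot] at h₁ h₂
  rw [← hr, ENat.toNat_add he ENat.one_ne_top, ENat.toNat_one] at h₂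
  have h₃ := (freeSlot_strictMono d _).lt_iff_lt.mp h₂
  have h₄ := (freeSlot_strictMono e _).lt_iff_lt.mp
    ((h₁.trans_le (freeSlot_le_freeSlot h (namesBelow r) n)))
  omega

end Slots

/-! ### Links -/

section Links

variable {V : Type*}

/-- The distance functions of two nodes that are joined by a link: they differ by at most one. -/
def Near (d e : V → ℕ∞) : Prop := d ≤ e + 1 ∧ e ≤ d + 1

namespace Near

variable {d e : V → ℕ∞}

theorem symm (h : Near d e) : Near e d := ⟨h.2, h.1⟩

theorem le_inf_add_one (h : Near d e) : d ≤ d ⊓ e + 1 := by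
  intro r
  rcases min_choice (d r) (e r) with hr | hr <;>
    simp only [Pi.add_apply, Pi.inf_apply, Pi.one_apply, hr]
  · exact le_self_add
  · exact h.1 r

theorem ne_top (h : Near d e) {r : V} (hr : d r ≠ ⊤) : e r ≠ ⊤ :=
  ne_top_of_le_ne_top (WithTop.add_ne_top.mpr ⟨hr, ENat.one_ne_top⟩) (h.2 r)

theorem ne_top_of_inf (h : Near d e) {r : V} (hr : (d ⊓ e) r ≠ ⊤) : d r ≠ ⊤ :=
  ne_top_of_le_ne_top (WithTop.add_ne_top.mpr ⟨hr, ENat.one_ne_top⟩) (h.le_inf_add_one r)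

theorem le_or_add_one_eq (h : Near d e) (r : V) : d r ≤ e r ∨ e r + 1 = d r := by
  rcases le_or_gt (d r) (e r) with hr | hr
  · exact Or.inl hr
  · exact Or.inr (le_antisymm (Order.add_one_le_of_lt hr) (h.1 r))

end Near

theorem inf_eq_of_add_one_eq {d e : V → ℕ∞} {r : V} (hr : e r + 1 = d r) : (d ⊓ e) r = e r :=
  min_eq_right (hr ▸ le_self_add)

variable [LinearOrder V] [Fintype V]

/-- The round in which `r` crosses the link between two nodes with distances `d` and `e`. -/
noncomputable def linkSlot (d e : V → ℕ∞) : V → ℕ := slot (d ⊓ e)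

theorem linkSlot_comm (d e : V → ℕ∞) : linkSlot d e = linkSlot e d := by
  rw [linkSlot, linkSlot, inf_comm]

theorem linkSlot_injOn (d e : V → ℕ∞) : Set.InjOn (linkSlot d e) {r | d r ≠ ⊤} :=
  (slot_injOn _).mono fun _ hr => ne_top_of_le_ne_top hr (min_le_left _ _)

theorem slot_le_linkSlot {d e : V → ℕ∞} {r : V} (hr : d r ≤ e r) : slot d r ≤ linkSlot d e r :=
  slot_le_slot_of_eq inf_le_left (min_eq_left hr)

theorem Near.exists_linkSlot_eq {d e : V → ℕ∞} (h : Near d e) {r : V} (hr : d r ≤ e r) {t : ℕ}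
    (h₁ : slot d r ≤ t) (h₂ : t < linkSlot d e r) : ∃ s < r, d s ≠ ⊤ ∧ linkSlot d e s = t := by
  obtain ⟨s, hs, hd, ht⟩ := exists_slot_eq_of_eq h.le_inf_add_one (min_eq_left hr) h₁ h₂
  exact ⟨s, hs, h.ne_top_of_inf hd, ht⟩

theorem Near.linkSlot_lt_slot {d e : V → ℕ∞} (h : Near d e) {r : V} (hr : e r + 1 = d r)
    (hd : d r ≠ ⊤) : linkSlot d e r < slot d r := by
  have hinf := inf_eq_of_add_one_eq hr
  exact slot_lt_slot_of_add_one_eq h.le_inf_add_one (by rw [hinf, hr]) (hinf ▸ h.ne_top hd)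

theorem Near.exists_slot_eq {d e : V → ℕ∞} (h : Near d e) {r : V} (hr : e r + 1 = d r)
    (hd : d r ≠ ⊤) {t : ℕ} (h₁ : linkSlot d e r < t) (h₂ : t < slot d r) :
    ∃ s < r, d s ≠ ⊤ ∧ slot d s = t := by
  have hinf := inf_eq_of_add_one_eq hr
  exact exists_slot_eq_of_add_one_eq inf_le_left (by rw [hinf, hr]) (hinf ▸ h.ne_top hd) h₁ h₂

/-- What a node with distances `d` may get in round `t` over a link from a node with distances `e`:
the root whose slot on the link is `t` if the link leads away from that root, and otherwise at most
a root that is too large to have an effect. -/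
structure Delivers (d e : V → ℕ∞) (t : ℕ) (m : Option (DLGMessage V)) : Prop where
  eq_some : ∀ r, d r ≠ ⊤ → linkSlot d e r = t → e r ≤ d r → m = some (r, (e r).toNat + 1)
  exists_le : ∀ r x, m = some (r, x) → ∃ s ≤ r, d s ≠ ⊤ ∧ linkSlot d e s = t

end Links

/-! ### The state of a node -/

/-- A node that runs the program, together with the distances that it and its neighbors have from
the roots: `dist` are its own distances and `peer i` those at the other end of the link `i`. -/
structure LocalDistances (V P : Type*) where
  links : List P
  dist : V → ℕ∞
  peer : P → V → ℕ∞
  nodup : links.Nodup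
  near : ∀ i ∈ links, Near dist (peer i)
  exists_parent : ∀ r, dist r ≠ ⊤ → dist r ≠ 0 → ∃ i ∈ links, peer i r + 1 = dist r
  root_unique : ∀ r s, dist r = 0 → dist s = 0 → r = s

namespace LocalDistances

variable {V P : Type*} (N : LocalDistances V P)

/-- The link `i` leads to a parent for the root `r`. -/
structure Parent (r : V) (i : P) : Prop where
  mem : i ∈ N.links
  add_one_eq : N.peer i r + 1 = N.dist r
  ne_top : N.dist r ≠ ⊤

section

variable {N} {r : V} {i : P}

theorem dist_le_or_parent (hi : i ∈ N.links) (hr : N.dist r ≠ ⊤) :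
    N.dist r ≤ N.peer i r ∨ N.Parent r i :=
  ((N.near i hi).le_or_add_one_eq r).imp_right fun h => ⟨hi, h, hr⟩

end

variable [LinearOrder V] [Fintype V]

/-- The round in which `r` crosses the link `i`. -/
noncomputable def crossTime (i : P) : V → ℕ := linkSlot N.dist (N.peer i)

/-- In round `t` the root `r` reaches the node over the link `i`. -/
def Arrives (t : ℕ) (r : V) (i : P) : Prop := N.Parent r i ∧ N.crossTime i r = t

/-- The node is the root `r` or has heard of it when everything that arrives over the links `i`
before the rounds `T i` has been processed. -/
def Heard (T : P → ℕ) (r : V) : Prop :=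
  N.dist r = 0 ∨ ∃ i, N.Parent r i ∧ N.crossTime i r < T i

/-- The root `r` has arrived by round `t`, but its slot is still to come. -/
def Pending (t : ℕ) (r : V) : Prop :=
  (∃ i, N.Parent r i ∧ N.crossTime i r ≤ t) ∧ t < slot N.dist r

/-- The variables of a node during the execution: each link `i` has its own clock `T i`, because
the links are processed one after the other, and the clock of the delay queue is `q`. -/
structure NodeInv (k : ℕ) (T : P → ℕ) (q : ℕ) (s : DLGState V P) : Prop where
  mem_L : ∀ r, r ∈ s.L ↔ N.Heard T r
  mem_Lp : ∀ i ∈ N.links, ∀ r, r ∈ s.Lp i ↔ r ∈ s.L ∧ T i ≤ N.crossTime i r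
  mem_delay : ∀ r, r ∈ s.delay ↔ r ∈ s.L ∧ q < slot N.dist r
  dist_eq : ∀ r, s.dist r = if r ∈ s.L then N.dist r else ⊤
  mem_parents : ∀ r i τ, (i, τ) ∈ s.parents r ↔
    N.Parent r i ∧ N.dist r ≤ k ∧ τ = N.crossTime i r ∧ τ < T i
  nodup_parents : ∀ r, (s.parents r).Nodup

/-- The variables of a node at the beginning of round `t`. -/
abbrev RoundInv (k t : ℕ) (s : DLGState V P) : Prop := N.NodeInv k (fun _ => t) t s

variable {N} {k t q : ℕ} {T : P → ℕ} {s : DLGState V P} {i : P} {r : V}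

theorem Parent.crossTime_lt_slot (h : N.Parent r i) : N.crossTime i r < slot N.dist r :=
  (N.near i h.mem).linkSlot_lt_slot h.add_one_eq h.ne_top

theorem crossTime_injOn (N : LocalDistances V P) (i : P) :
    Set.InjOn (N.crossTime i) {r | N.dist r ≠ ⊤} :=
  linkSlot_injOn _ _

theorem slot_root (hr : N.dist r = 0) : slot N.dist r = 0 :=
  slot_eq_zero hr fun s hs h => hs.ne (N.root_unique s r h hr)

theorem Heard.ne_top (h : N.Heard T r) : N.dist r ≠ ⊤ := by
  rcases h with h | ⟨i, h, _⟩
  · exact h ▸ ENat.zero_ne_top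
  · exact h.ne_top

theorem heard_of_slot_le (hr : N.dist r ≠ ⊤) (h : slot N.dist r ≤ t) :
    N.Heard (fun _ => t) r := by
  by_cases h0 : N.dist r = 0
  · exact Or.inl h0
  · obtain ⟨i, hi, hp⟩ := N.exists_parent r hr h0
    have hpar : N.Parent r i := ⟨hi, hp, hr⟩
    exact Or.inr ⟨i, hpar, hpar.crossTime_lt_slot.trans_le h⟩

namespace NodeInv

theorem ne_top_of_mem (hs : N.NodeInv k T q s) (hr : r ∈ s.L) : N.dist r ≠ ⊤ :=
  ((hs.mem_L r).mp hr).ne_top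

end NodeInv

namespace RoundInv

theorem mem_Lp_sdiff_delay (hs : N.RoundInv k t s) (hi : i ∈ N.links) :
    r ∈ s.Lp i \ s.delay ↔ N.dist r ≠ ⊤ ∧ slot N.dist r ≤ t ∧ t ≤ N.crossTime i r := by
  rw [Finset.mem_sdiff, hs.mem_Lp i hi, hs.mem_delay]
  constructor
  · rintro ⟨⟨hL, hcross⟩, hslot⟩
    exact ⟨hs.ne_top_of_mem hL, not_lt.mp fun h => hslot ⟨hL, h⟩, hcross⟩
  · rintro ⟨hr, hslot, hcross⟩
    exact ⟨⟨(hs.mem_L r).mpr (heard_of_slot_le hr hslot), hcross⟩, fun h => h.2.not_ge hslot⟩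

-- A root that waits for its slot on the link waits because a smaller root uses the link.
theorem exists_le_crossTime_eq (hs : N.RoundInv k t s) (hi : i ∈ N.links)
    (hr : r ∈ s.Lp i \ s.delay) : ∃ r' ≤ r, N.dist r' ≠ ⊤ ∧ N.crossTime i r' = t := by
  obtain ⟨hd, hslot, hcross⟩ := (hs.mem_Lp_sdiff_delay hi).mp hr
  rcases hcross.eq_or_lt with h | h
  · exact ⟨r, le_rfl, hd, h.symm⟩
  · rcases dist_le_or_parent hi hd with hle | hpar
    · obtain ⟨r', hlt, h'⟩ := (N.near i hi).exists_linkSlot_eq hle hslot h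
      exact ⟨r', hlt.le, h'⟩
    · exact absurd (h.trans hpar.crossTime_lt_slot) hslot.not_gt

theorem exists_le_of_next_eq (hs : N.RoundInv k t s) (hi : i ∈ N.links) (h : s.next i = r) :
    ∃ r' ≤ r, N.dist r' ≠ ⊤ ∧ N.crossTime i r' = t :=
  hs.exists_le_crossTime_eq hi (Finset.mem_of_min h)

theorem next_eq (hs : N.RoundInv k t s) (hi : i ∈ N.links) (hd : N.dist r ≠ ⊤)
    (hle : N.dist r ≤ N.peer i r) (ht : N.crossTime i r = t) : s.next i = r := by
  have hmem : r ∈ s.Lp i \ s.delay :=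
    (hs.mem_Lp_sdiff_delay hi).mpr ⟨hd, ht ▸ slot_le_linkSlot hle, ht.ge⟩
  refine le_antisymm (Finset.min_le hmem) (Finset.le_min fun r' hr' => ?_)
  obtain ⟨r'', hle', hd', ht'⟩ := hs.exists_le_crossTime_eq hi hr'
  rw [N.crossTime_injOn i hd hd' (ht.trans ht'.symm)]
  exact WithTop.coe_le_coe.mpr hle'

theorem lt_next (hs : N.RoundInv k t s) (h : N.Arrives t r i) : (r : WithTop V) < s.next i := by
  obtain ⟨hpar, ht⟩ := h
  rcases hn : s.next i with _ | l
  · exact WithTop.coe_lt_top r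
  · obtain ⟨r', hle, hd, ht'⟩ := hs.exists_le_of_next_eq hpar.mem hn
    obtain rfl := N.crossTime_injOn i hd hpar.ne_top (ht'.trans ht.symm)
    refine WithTop.coe_lt_coe.mpr (hle.lt_of_ne ?_)
    rintro rfl
    have hslot := ((hs.mem_Lp_sdiff_delay hpar.mem).mp (Finset.mem_of_min hn)).2.1
    exact (hslot.trans_eq ht.symm).not_gt hpar.crossTime_lt_slot

theorem coe_eq_next_iff (hs : N.RoundInv k t s) (hi : i ∈ N.links)
    (harr : ∀ r, ¬ N.Arrives t r i) (hr : N.dist r ≠ ⊤) :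
    (r : WithTop V) = s.next i ↔ N.crossTime i r = t := by
  have next_of_crossTime {r : V} (hr : N.dist r ≠ ⊤) (ht : N.crossTime i r = t) :
      s.next i = r := by
    rcases dist_le_or_parent hi hr with hle | hpar
    · exact hs.next_eq hi hr hle ht
    · exact absurd ⟨hpar, ht⟩ (harr r)
  refine ⟨fun h => ?_, fun ht => (next_of_crossTime hr ht).symm⟩
  obtain ⟨r', -, hd, ht⟩ := hs.exists_le_of_next_eq hi h.symm
  rwa [WithTop.coe_injective (h.trans (next_of_crossTime hd ht))]

theorem mem_L_of_next_eq (hs : N.RoundInv k t s) (hi : i ∈ N.links) (h : s.next i = r) :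
    r ∈ s.L :=
  ((hs.mem_Lp i hi r).mp (Finset.mem_sdiff.mp (Finset.mem_of_min h)).1).1

theorem outgoing_eq_some (hs : N.RoundInv k t s) (hi : i ∈ N.links) (h : s.next i = r) :
    s.outgoing i = some (r, (N.dist r).toNat + 1) := by
  simp only [DLGState.outgoing, h, hs.dist_eq, if_pos (hs.mem_L_of_next_eq hi h)]

theorem of_outgoing_eq_some (hs : N.RoundInv k t s) (hi : i ∈ N.links) {x : ℕ}
    (h : s.outgoing i = some (r, x)) :
    s.next i = r ∧ N.dist r ≠ ⊤ ∧ x = (N.dist r).toNat + 1 := by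
  rcases hn : s.next i with _ | l
  · simp [DLGState.outgoing, hn] at h
  · rw [hs.outgoing_eq_some hi hn] at h
    cases h
    exact ⟨rfl, ((hs.mem_L r).mp (hs.mem_L_of_next_eq hi hn)).ne_top, rfl⟩

theorem delivers (hs : N.RoundInv k t s) (hi : i ∈ N.links) :
    Delivers (N.peer i) N.dist t (s.outgoing i) where
  eq_some r hr ht hle := by
    rw [linkSlot_comm] at ht
    exact hs.outgoing_eq_some hi (hs.next_eq hi ((N.near i hi).symm.ne_top hr) hle ht)
  exists_le r x hm := by
    obtain ⟨hn, -, -⟩ := hs.of_outgoing_eq_some hi hm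
    obtain ⟨r', hle, hd, ht⟩ := hs.exists_le_of_next_eq hi hn
    exact ⟨r', hle, (N.near i hi).ne_top hd, by rwa [linkSlot_comm]⟩

theorem not_rootOf_lt_next (hs : N.RoundInv k t s) (hi : i ∈ N.links)
    (harr : ∀ r, ¬ N.Arrives t r i) {m : Option (DLGMessage V)}
    (hm : Delivers N.dist (N.peer i) t m) : ¬ DLGState.rootOf m < s.next i := by
  rcases m with _ | ⟨r, x⟩
  · exact not_top_lt
  · obtain ⟨r', hle, hd, ht⟩ := hm.exists_le r x rfl
    rw [← (hs.coe_eq_next_iff hi harr hd).mpr ht]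
    exact (WithTop.coe_le_coe.mpr hle).not_gt

end RoundInv

theorem Arrives.eq_some {m : Option (DLGMessage V)} (h : N.Arrives t r i)
    (hm : Delivers N.dist (N.peer i) t m) : m = some (r, (N.dist r).toNat) := by
  obtain ⟨hpar, ht⟩ := h
  have hpeer := (N.near i hpar.mem).ne_top hpar.ne_top
  rw [hm.eq_some r hpar.ne_top ht (hpar.add_one_eq ▸ le_self_add), ← hpar.add_one_eq,
    ENat.toNat_add hpeer ENat.one_ne_top, ENat.toNat_one]

end LocalDistances

/-! ### One round of the program -/

theorem toNat_le_iff {a : ℕ∞} {n : ℕ} (ha : a ≠ ⊤) : a.toNat ≤ n ↔ a ≤ n := by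
  lift a to ℕ using ha
  simp

namespace DLGState

variable {V P : Type*} [LinearOrder V]

/-- The set `R` of the roots that are new to the node in a round with inbox `inc`. -/
def fresh (links : List P) (inc : P → Option (DLGMessage V)) (s : DLGState V P) : Finset V :=
  (links.filterMap fun i =>
    if rootOf (inc i) < s.next i then (inc i).map Prod.fst else none).toFinset \ s.L

/-- The state after the update of the delay queue when `m = min R`. -/
def release (m : WithTop V) (s : DLGState V P) : DLGState V P :=
  if s.delay.min ≤ m ∧ s.delay.min < ⊤ then
    { s with delay := s.delay.filter (fun v => (v : WithTop V) ≠ s.delay.min) }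
  else s

/-- The parents after `i` has been recorded, at time `t`, as a parent for the root `r` at distance
`d`, unless the depth `k` is exceeded. -/
def recordParent (k t : ℕ) (r : V) (d : ℕ) (i : P) (s : DLGState V P) : V → List (P × ℕ) :=
  if d ≤ k then Function.update s.parents r (s.parents r ++ [(i, t)]) else s.parents

theorem release_eq (m : WithTop V) (s : DLGState V P) :
    s.release m = { s with delay := (s.release m).delay } := by
  unfold release
  split_ifs <;> rfl

theorem mem_release_delay {m : WithTop V} {s : DLGState V P} {r : V} :
    r ∈ (s.release m).delay ↔ r ∈ s.delay ∧ ¬ (r ≤ s.delay.min ∧ r ≤ m) := by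
  by_cases hr : r ∈ s.delay
  · have hmin : (r : WithTop V) ≤ s.delay.min ↔ (r : WithTop V) = s.delay.min :=
      ⟨fun h => h.antisymm (Finset.min_le hr), fun h => h.le⟩
    have htop : s.delay.min < ⊤ := (Finset.min_le hr).trans_lt (WithTop.coe_lt_top r)
    rw [hmin]
    simp only [release, htop, and_true]
    split_ifs with hm
    · simp only [Finset.mem_filter, hr, ne_eq, true_and, not_and]
      exact ⟨fun h h' => absurd h' h, fun h h' => h h' (h' ▸ hm)⟩
    · simpa only [hr, true_and, not_and, true_iff] using fun h => h ▸ hm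
  · simp only [release, hr, false_and, iff_false]
    split_ifs
    · exact fun h => hr (Finset.mem_of_mem_filter r h)
    · exact hr

theorem mem_recordParent {k t d : ℕ} {r r' : V} {i j : P} {τ : ℕ} {s : DLGState V P} :
    (j, τ) ∈ s.recordParent k t r d i r' ↔
      (j, τ) ∈ s.parents r' ∨ r' = r ∧ d ≤ k ∧ j = i ∧ τ = t := by
  unfold recordParent
  split_ifs with hd <;> rcases eq_or_ne r' r with rfl | hr
  · simp [hd]
  · simp [hr]
  all_goals simp [hd]

theorem nodup_recordParent {k t d : ℕ} {r r' : V} {i : P} {s : DLGState V P}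
    (h : (s.parents r').Nodup) (hi : (i, t) ∉ s.parents r) :
    (s.recordParent k t r d i r').Nodup := by
  unfold recordParent
  split_ifs
  · rcases eq_or_ne r' r with rfl | hr
    · rw [Function.update_self, List.nodup_append]
      refine ⟨h, List.nodup_singleton _, ?_⟩
      rintro p hp _ hmem rfl
      exact hi (List.mem_singleton.mp hmem ▸ hp)
    · rwa [Function.update_of_ne hr]
  · exact h

variable [DecidableEq P]

theorem round_eq (k t : ℕ) (links : List P) (inc : P → Option (DLGMessage V))
    (s : DLGState V P) :
    s.round k t links inc =
      links.foldl (process k t s.next inc (s.fresh links inc).min s.delay.min)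
        (s.release (s.fresh links inc).min) :=
  rfl

variable {k t d : ℕ} {l : P → WithTop V} {inc : P → Option (DLGMessage V)} {m q : WithTop V}
  {s : DLGState V P} {i : P} {r : V}

theorem process_of_not_lt (h : ¬ rootOf (inc i) < l i) :
    process k t l inc m q s i =
      { s with Lp := Function.update s.Lp i ((s.Lp i).filter fun v => (v : WithTop V) ≠ l i) } :=
  if_neg h

theorem process_of_mem (hinc : inc i = some (r, d)) (hl : r < l i) (hd : d ≤ s.dist r)
    (hr : r ∈ s.L) :
    process k t l inc m q s i =
      { s with
        parents := s.recordParent k t r d i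
        Lp := Function.update s.Lp i ((s.Lp i).erase r) } := by
  have hlt : rootOf (some (r, d)) < l i := hl
  simp only [process, hinc, if_pos hlt, if_pos hd, hr, not_true_eq_false, if_false, recordParent]
  split_ifs <;> rfl

theorem process_of_notMem (hinc : inc i = some (r, d)) (hl : r < l i) (hd : d ≤ s.dist r)
    (hr : r ∉ s.L) :
    process k t l inc m q s i =
      { dist := Function.update s.dist r d
        L := insert r s.L
        Lp := fun j => if j = i then s.Lp j else insert r (s.Lp j)
        delay := if m < r ∨ q < r then insert r s.delay else s.delay
        parents := s.recordParent k t r d i } := by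
  have hlt : rootOf (some (r, d)) < l i := hl
  simp only [process, hinc, if_pos hlt, if_pos hd, hr, not_false_eq_true, if_true, recordParent]
  split_ifs <;> rfl

end DLGState

namespace LocalDistances

variable {V P : Type*} [LinearOrder V] [Fintype V] {N : LocalDistances V P} {k t q : ℕ}
  {s : DLGState V P} {inc : P → Option (DLGMessage V)} {r : V}

theorem pending_of_slot_eq (hr : N.dist r ≠ ⊤) (h : slot N.dist r = t + 1) : N.Pending t r := by
  have h0 : N.dist r ≠ 0 := by
    intro h0
    rw [slot_root h0] at h
    exact t.succ_ne_zero h.symm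
  obtain ⟨i, hi, hp⟩ := N.exists_parent r hr h0
  have hpar : N.Parent r i := ⟨hi, hp, hr⟩
  exact ⟨⟨i, hpar, Nat.le_of_lt_succ (hpar.crossTime_lt_slot.trans_eq h)⟩, h ▸ t.lt_succ_self⟩

theorem Pending.ne_top (h : N.Pending t r) : N.dist r ≠ ⊤ :=
  let ⟨⟨_, hpar, _⟩, _⟩ := h
  hpar.ne_top

theorem Pending.exists_le_slot_eq (h : N.Pending t r) :
    ∃ r' ≤ r, N.Pending t r' ∧ slot N.dist r' = t + 1 := by
  obtain ⟨⟨i, hpar, hcross⟩, hslot⟩ := h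
  rcases (Nat.succ_le_of_lt hslot).eq_or_lt with heq | hlt
  · exact ⟨r, le_rfl, ⟨⟨i, hpar, hcross⟩, hslot⟩, heq.symm⟩
  · obtain ⟨r', hr', hd, ht⟩ := (N.near i hpar.mem).exists_slot_eq hpar.add_one_eq hpar.ne_top
      (Nat.lt_succ_of_le hcross) hlt
    exact ⟨r', hr'.le, pending_of_slot_eq hd ht, ht⟩

theorem Pending.slot_eq_iff (h : N.Pending t r) :
    slot N.dist r = t + 1 ↔ ∀ r', N.Pending t r' → r ≤ r' := by
  constructor
  · intro hslot r' h'
    obtain ⟨r'', hle, h'', hslot'⟩ := h'.exists_le_slot_eq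
    rwa [slot_injOn N.dist h.ne_top h''.ne_top (hslot.trans hslot'.symm)]
  · intro hmin
    obtain ⟨r', hle, h', hslot⟩ := h.exists_le_slot_eq
    rwa [(hmin r' h').antisymm hle]

namespace RoundInv

theorem mem_fresh (hs : N.RoundInv k t s)
    (hinc : ∀ i ∈ N.links, Delivers N.dist (N.peer i) t (inc i)) :
    r ∈ s.fresh N.links inc ↔ r ∉ s.L ∧ ∃ i, N.Arrives t r i := by
  rw [DLGState.fresh, Finset.mem_sdiff, List.mem_toFinset, List.mem_filterMap, and_comm]
  refine and_congr_right fun _ => ⟨?_, ?_⟩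
  · rintro ⟨i, hi, h⟩
    by_cases harr : ∃ r', N.Arrives t r' i
    · obtain ⟨r', harr⟩ := harr
      rw [harr.eq_some (hinc i hi)] at h
      obtain rfl : r' = r := by simpa [DLGState.rootOf, hs.lt_next harr] using h
      exact ⟨i, harr⟩
    · rw [if_neg (hs.not_rootOf_lt_next hi (not_exists.mp harr) (hinc i hi))] at h
      cases h
  · rintro ⟨i, harr⟩
    refine ⟨i, harr.1.mem, ?_⟩
    simp [harr.eq_some (hinc i harr.1.mem), DLGState.rootOf, hs.lt_next harr]

theorem mem_delay_or_mem_fresh (hs : N.RoundInv k t s)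
    (hinc : ∀ i ∈ N.links, Delivers N.dist (N.peer i) t (inc i)) :
    r ∈ s.delay ∨ r ∈ s.fresh N.links inc ↔ N.Pending t r := by
  rw [hs.mem_fresh hinc, hs.mem_delay, hs.mem_L]
  constructor
  · rintro (⟨h0 | ⟨i, hpar, hcross⟩, hslot⟩ | ⟨-, i, hpar, rfl⟩)
    · exact absurd hslot (slot_root h0 ▸ Nat.not_lt_zero t)
    · exact ⟨⟨i, hpar, hcross.le⟩, hslot⟩
    · exact ⟨⟨i, hpar, le_rfl⟩, hpar.crossTime_lt_slot⟩
  · rintro ⟨⟨i, hpar, hcross⟩, hslot⟩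
    by_cases hr : N.Heard (fun _ => t) r
    · exact Or.inl ⟨hr, hslot⟩
    · refine Or.inr ⟨hr, i, hpar, hcross.antisymm (not_lt.mp fun h => hr (Or.inr ⟨i, hpar, h⟩))⟩

theorem slot_eq_iff_le_min (hs : N.RoundInv k t s)
    (hinc : ∀ i ∈ N.links, Delivers N.dist (N.peer i) t (inc i)) (hr : N.Pending t r) :
    slot N.dist r = t + 1 ↔ r ≤ s.delay.min ∧ r ≤ (s.fresh N.links inc).min := by
  simp only [hr.slot_eq_iff, ← hs.mem_delay_or_mem_fresh hinc, or_imp, forall_and,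
    Finset.le_min_iff, WithTop.coe_le_coe]

theorem release (hs : N.RoundInv k t s)
    (hinc : ∀ i ∈ N.links, Delivers N.dist (N.peer i) t (inc i)) :
    N.NodeInv k (fun _ => t) (t + 1) (s.release (s.fresh N.links inc).min) := by
  rw [DLGState.release_eq]
  refine ⟨hs.mem_L, hs.mem_Lp, fun r => ?_, hs.dist_eq, hs.mem_parents, hs.nodup_parents⟩
  simp only [DLGState.mem_release_delay]
  have hdelay : r ∈ s.delay ∧ ¬ (r ≤ s.delay.min ∧ r ≤ (s.fresh N.links inc).min) ↔
      r ∈ s.delay ∧ ¬ slot N.dist r = t + 1 :=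
    and_congr_right fun h => by
      rw [hs.slot_eq_iff_le_min hinc ((hs.mem_delay_or_mem_fresh hinc).mp (Or.inl h))]
  rw [hdelay, hs.mem_delay, and_assoc]
  exact and_congr_right fun _ => by omega

theorem min_lt_iff (hs : N.RoundInv k t s)
    (hinc : ∀ i ∈ N.links, Delivers N.dist (N.peer i) t (inc i)) {i : P} (h : N.Arrives t r i) :
    (s.fresh N.links inc).min < r ∨ s.delay.min < r ↔ t + 1 < slot N.dist r := by
  have hslot : t < slot N.dist r := h.2 ▸ h.1.crossTime_lt_slot
  rw [← not_iff_not, not_or, not_lt, not_lt, and_comm,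
    ← hs.slot_eq_iff_le_min hinc ⟨⟨i, h.1, h.2.le⟩, hslot⟩]
  omega

end RoundInv

theorem Arrives.crossTime_eq_iff {i : P} {r' : V} (h : N.Arrives t r i) (hr' : N.dist r' ≠ ⊤) :
    N.crossTime i r' = t ↔ r' = r := by
  rw [← h.2]
  exact (N.crossTime_injOn i).eq_iff hr' h.1.ne_top

theorem Arrives.arrives_iff {i : P} {r' : V} (h : N.Arrives t r i) :
    N.Arrives t r' i ↔ r' = r :=
  ⟨fun h' => (h.crossTime_eq_iff h'.1.ne_top).mp h'.2, fun h' => h' ▸ h⟩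

variable {T : P → ℕ} {i : P}

namespace NodeInv

theorem congr {T' : P → ℕ} (hs : N.NodeInv k T q s) (hT : ∀ i ∈ N.links, T i = T' i) :
    N.NodeInv k T' q s where
  mem_L r := by
    rw [hs.mem_L]
    refine or_congr_right (exists_congr fun i => and_congr_right fun hpar => ?_)
    rw [hT i hpar.mem]
  mem_Lp i hi r := hT i hi ▸ hs.mem_Lp i hi r
  mem_delay := hs.mem_delay
  dist_eq := hs.dist_eq
  mem_parents r i τ := by
    rw [hs.mem_parents]
    refine and_congr_right fun hpar => ?_
    rw [hT i hpar.mem]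
  nodup_parents := hs.nodup_parents

theorem nodup_recordParent (hs : N.NodeInv k T q s) (r' : V) :
    (s.recordParent k (T i) r (N.dist r).toNat i r').Nodup :=
  DLGState.nodup_recordParent (hs.nodup_parents r')
    fun h => lt_irrefl _ ((hs.mem_parents _ _ _).mp h).2.2.2

theorem le_crossTime_of_notMem (hs : N.NodeInv k T q s) (harr : N.Arrives (T i) r i)
    (hr : r ∉ s.L) {j : P} (hj : j ∈ N.links) (hT : T j ≤ T i + 1) : T j ≤ N.crossTime j r := by
  rcases dist_le_or_parent hj harr.1.ne_top with hle | hpar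
  · calc T j ≤ T i + 1 := hT
      _ ≤ slot N.dist r := by rw [← harr.2]; exact harr.1.crossTime_lt_slot
      _ ≤ N.crossTime j r := slot_le_linkSlot hle
  · exact not_lt.mp fun h => hr ((hs.mem_L r).mpr (Or.inr ⟨j, hpar, h⟩))

end NodeInv

theorem roundInv_idle (h : ∀ r, N.dist r ≠ 0) : N.RoundInv k 0 DLGState.idle := by
  constructor <;> simp [DLGState.idle, Heard, h]

theorem roundInv_root {u : V} (h : ∀ r, N.dist r = 0 ↔ r = u) :
    N.RoundInv k 0 (DLGState.root u) where
  mem_L r := by simp [DLGState.root, Heard, h]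
  mem_Lp := by simp [DLGState.root]
  mem_delay r := by
    simp only [DLGState.root, Finset.notMem_empty, Finset.mem_singleton, false_iff, not_and, not_lt]
    rintro rfl
    rw [slot_root ((h r).mpr rfl)]
  dist_eq r := by
    simp only [DLGState.root, Finset.mem_singleton]
    split_ifs with hr
    exacts [((h r).mpr hr).symm, rfl]
  mem_parents := by simp [DLGState.root]
  nodup_parents _ := List.nodup_nil

variable [DecidableEq P]

theorem lt_update_add_one_iff {j : P} {τ : ℕ} :
    τ < Function.update T i (T i + 1) j ↔ τ < T j ∨ j = i ∧ τ = T i := by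
  rcases eq_or_ne j i with rfl | hj
  · simp [le_iff_lt_or_eq]
  · simp [hj]

theorem heard_update_iff :
    N.Heard (Function.update T i (T i + 1)) r ↔ N.Heard T r ∨ N.Arrives (T i) r i := by
  simp only [Heard, Arrives, lt_update_add_one_iff, and_or_left, exists_or, or_assoc]
  refine or_congr_right (or_congr_right ⟨?_, fun h => ⟨i, h.1, rfl, h.2⟩⟩)
  rintro ⟨_, hpar, rfl, ht⟩
  exact ⟨hpar, ht⟩

namespace NodeInv

theorem mem_update_Lp (hs : N.NodeInv k T q s) {X : Finset V}
    (hX : ∀ r ∈ s.L, r ∈ X ↔ r ∈ s.Lp i ∧ N.crossTime i r ≠ T i) (hXL : X ⊆ s.L) :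
    ∀ j ∈ N.links, ∀ r, r ∈ Function.update s.Lp i X j ↔
      r ∈ s.L ∧ Function.update T i (T i + 1) j ≤ N.crossTime j r := by
  intro j hj r
  rcases eq_or_ne j i with rfl | hji
  · rw [Function.update_self, Function.update_self, ← and_iff_right_of_imp (@hXL r)]
    refine and_congr_right fun hr => ?_
    rw [hX r hr, hs.mem_Lp j hj]
    simp only [hr, true_and]
    omega
  · rw [Function.update_of_ne hji, Function.update_of_ne hji, hs.mem_Lp j hj]

theorem announce (hs : N.NodeInv k T q s) (hi : i ∈ N.links)
    (harr : ∀ r, ¬ N.Arrives (T i) r i) {l : WithTop V}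
    (hl : ∀ r : V, N.dist r ≠ ⊤ → ((r : WithTop V) = l ↔ N.crossTime i r = T i)) :
    N.NodeInv k (Function.update T i (T i + 1)) q
      { s with Lp := Function.update s.Lp i ((s.Lp i).filter fun v => (v : WithTop V) ≠ l) } where
  mem_L r := by simp only [heard_update_iff, harr, or_false, hs.mem_L]
  mem_Lp := hs.mem_update_Lp
    (fun r hr => by rw [Finset.mem_filter, Ne, hl r (hs.ne_top_of_mem hr)])
    fun r hr => ((hs.mem_Lp i hi r).mp (Finset.mem_of_mem_filter r hr)).1
  mem_delay := hs.mem_delay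
  dist_eq := hs.dist_eq
  mem_parents r j τ := by
    rw [lt_update_add_one_iff, hs.mem_parents]
    refine ⟨fun ⟨hpar, hk, hτ, hlt⟩ => ⟨hpar, hk, hτ, Or.inl hlt⟩, ?_⟩
    rintro ⟨hpar, hk, rfl, hlt | ⟨rfl, hτ⟩⟩
    · exact ⟨hpar, hk, rfl, hlt⟩
    · exact absurd ⟨hpar, hτ⟩ (harr r)
  nodup_parents := hs.nodup_parents

theorem mem_recordParent (hs : N.NodeInv k T q s) (harr : N.Arrives (T i) r i) (r' : V) (j : P)
    (τ : ℕ) :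
    (j, τ) ∈ s.recordParent k (T i) r (N.dist r).toNat i r' ↔
      N.Parent r' j ∧ N.dist r' ≤ k ∧ τ = N.crossTime j r' ∧
        τ < Function.update T i (T i + 1) j := by
  rw [DLGState.mem_recordParent, hs.mem_parents, lt_update_add_one_iff]
  constructor
  · rintro (⟨hpar, hk, hτ, hlt⟩ | ⟨rfl, hk, rfl, rfl⟩)
    · exact ⟨hpar, hk, hτ, Or.inl hlt⟩
    · exact ⟨harr.1, (toNat_le_iff harr.1.ne_top).mp hk, harr.2.symm, Or.inr ⟨rfl, rfl⟩⟩
  · rintro ⟨hpar, hk, hτ, hlt | ⟨rfl, rfl⟩⟩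
    · exact Or.inl ⟨hpar, hk, hτ, hlt⟩
    · obtain rfl := (harr.crossTime_eq_iff hpar.ne_top).mp hτ.symm
      exact Or.inr ⟨rfl, (toNat_le_iff hpar.ne_top).mpr hk, rfl, rfl⟩

theorem receive_of_mem (hs : N.NodeInv k T q s) (harr : N.Arrives (T i) r i) (hr : r ∈ s.L) :
    N.NodeInv k (Function.update T i (T i + 1)) q
      { s with
        parents := s.recordParent k (T i) r (N.dist r).toNat i
        Lp := Function.update s.Lp i ((s.Lp i).erase r) } where
  mem_L r' := by
    rw [heard_update_iff, harr.arrives_iff, ← hs.mem_L, or_iff_left_of_imp]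
    rintro rfl
    exact hr
  mem_Lp := by
    refine hs.mem_update_Lp (fun r' hr' => ?_) fun r' hr' => ?_
    · rw [Finset.mem_erase, and_comm, Ne, Ne, harr.crossTime_eq_iff (hs.ne_top_of_mem hr')]
    · exact ((hs.mem_Lp i harr.1.mem r').mp (Finset.mem_of_mem_erase hr')).1
  mem_delay := hs.mem_delay
  dist_eq := hs.dist_eq
  mem_parents := hs.mem_recordParent harr
  nodup_parents := hs.nodup_recordParent

theorem mem_Lp_of_arrives (hs : N.NodeInv k T q s) (harr : N.Arrives (T i) r i) (hr : r ∉ s.L)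
    {j : P} (hj : j ∈ N.links) (hT : T j ≤ T i + 1) (r' : V) :
    r' ∈ (if j = i then s.Lp j else insert r (s.Lp j)) ↔
      r' ∈ insert r s.L ∧ Function.update T i (T i + 1) j ≤ N.crossTime j r' := by
  rcases eq_or_ne j i with rfl | hji
  · rw [if_pos rfl, Function.update_self, hs.mem_Lp j hj, Finset.mem_insert]
    constructor
    · rintro ⟨hr', hle⟩
      refine ⟨Or.inr hr', hle.lt_of_ne' ?_⟩
      rw [Ne, harr.crossTime_eq_iff (hs.ne_top_of_mem hr')]
      exact ne_of_mem_of_not_mem hr' hr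
    · rintro ⟨rfl | hr', hle⟩
      · exact absurd harr.2 (Nat.lt_of_succ_le hle).ne'
      · exact ⟨hr', (Nat.le_succ _).trans hle⟩
  · rw [if_neg hji, Function.update_of_ne hji, Finset.mem_insert, Finset.mem_insert,
      hs.mem_Lp j hj, or_and_right]
    refine or_congr_left (iff_self_and.mpr ?_)
    rintro rfl
    exact hs.le_crossTime_of_notMem harr hr hj hT

theorem receive_of_notMem (hs : N.NodeInv k T q s) (harr : N.Arrives (T i) r i) (hr : r ∉ s.L)
    (hT : ∀ j ∈ N.links, T j ≤ T i + 1) {c : Prop} [Decidable c]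
    (hc : c ↔ q < slot N.dist r) :
    N.NodeInv k (Function.update T i (T i + 1)) q
      { dist := Function.update s.dist r (N.dist r).toNat
        L := insert r s.L
        Lp := fun j => if j = i then s.Lp j else insert r (s.Lp j)
        delay := if c then insert r s.delay else s.delay
        parents := s.recordParent k (T i) r (N.dist r).toNat i } where
  mem_L r' := by
    rw [Finset.mem_insert, heard_update_iff, harr.arrives_iff, hs.mem_L, or_comm]
  mem_Lp j hj r' := hs.mem_Lp_of_arrives harr hr hj (hT j hj) r'
  mem_delay r' := by
    have hdelay : r' ∈ (if c then insert r s.delay else s.delay) ↔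
        r' = r ∧ q < slot N.dist r ∨ r' ∈ s.delay := by
      rw [← hc]
      split_ifs with h <;> simp [h]
    refine hdelay.trans ?_
    rw [hs.mem_delay, Finset.mem_insert, or_and_right]
    exact or_congr_left (and_congr_right fun h => by rw [h])
  dist_eq r' := by
    rcases eq_or_ne r' r with rfl | hne
    · simp [ENat.natCast_toNat harr.1.ne_top]
    · simp [hne, hs.dist_eq]
  mem_parents := hs.mem_recordParent harr
  nodup_parents := hs.nodup_recordParent

end NodeInv

namespace RoundInv

variable {s' : DLGState V P}

theorem process (hs : N.RoundInv k t s)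
    (hinc : ∀ i ∈ N.links, Delivers N.dist (N.peer i) t (inc i))
    (h : N.NodeInv k T (t + 1) s') (hi : i ∈ N.links) (hTi : T i = t)
    (hT : ∀ j ∈ N.links, T j ≤ t + 1) :
    N.NodeInv k (Function.update T i (t + 1)) (t + 1)
      (DLGState.process k t s.next inc (s.fresh N.links inc).min s.delay.min s' i) := by
  subst hTi
  by_cases harr : ∃ r, N.Arrives (T i) r i
  · obtain ⟨r, harr⟩ := harr
    have hm := harr.eq_some (hinc i hi)
    have hlt := hs.lt_next harr
    have hd : ((N.dist r).toNat : ℕ∞) ≤ s'.dist r := by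
      rw [ENat.natCast_toNat harr.1.ne_top, h.dist_eq]
      split_ifs
      exacts [le_rfl, le_top]
    by_cases hr : r ∈ s'.L
    · rw [DLGState.process_of_mem hm hlt hd hr]
      exact h.receive_of_mem harr hr
    · rw [DLGState.process_of_notMem hm hlt hd hr]
      exact h.receive_of_notMem harr hr hT (hs.min_lt_iff hinc harr)
  · have harr := not_exists.mp harr
    rw [DLGState.process_of_not_lt (hs.not_rootOf_lt_next hi harr (hinc i hi))]
    exact h.announce hi harr fun r hr => hs.coe_eq_next_iff hi harr hr

theorem foldl_process (hs : N.RoundInv k t s)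
    (hinc : ∀ i ∈ N.links, Delivers N.dist (N.peer i) t (inc i)) {rest : List P}
    (hnodup : rest.Nodup) (hrest : rest ⊆ N.links)
    (h : N.NodeInv k (fun i => if i ∈ rest then t else t + 1) (t + 1) s') :
    N.NodeInv k (fun _ => t + 1) (t + 1) (rest.foldl
      (DLGState.process k t s.next inc (s.fresh N.links inc).min s.delay.min) s') := by
  induction rest generalizing s' with
  | nil => simpa using h
  | cons i rest ih =>
    rw [List.nodup_cons] at hnodup
    rw [List.cons_subset] at hrest
    refine ih hnodup.2 hrest.2 ?_
    have hclock : (fun j => if j ∈ rest then t else t + 1) =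
        Function.update (fun j => if j ∈ i :: rest then t else t + 1) i (t + 1) := by
      funext j
      rcases eq_or_ne j i with rfl | hj
      · simp [hnodup.1]
      · simp [hj]
    rw [hclock]
    exact hs.process hinc h hrest.1 (by simp) fun j _ => by split_ifs <;> omega

theorem round (hs : N.RoundInv k t s)
    (hinc : ∀ i ∈ N.links, Delivers N.dist (N.peer i) t (inc i)) :
    N.RoundInv k (t + 1) (s.round k t N.links inc) := by
  rw [DLGState.round_eq]
  refine hs.foldl_process hinc N.nodup (List.Subset.refl _) ?_
  exact (hs.release hinc).congr fun i hi => (if_pos hi).symm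

end RoundInv

end LocalDistances

/-! ### Weighted distances -/

section WeightedDistance

variable {V : Type*} {G : SimpleGraph V} {ω : Sym2 V → ℕ}

theorem wdist_le {u v : V} (p : G.Walk u v) : wdist G ω u v ≤ ((p.edges.map ω).sum : ℕ) :=
  iInf_le _ p

theorem exists_walk_of_wdist_ne_top {u v : V} (h : wdist G ω u v ≠ ⊤) :
    ∃ p : G.Walk u v, (((p.edges.map ω).sum : ℕ) : ℕ∞) = wdist G ω u v := by
  have hne : Nonempty (G.Walk u v) := by
    by_contra hemp
    rw [not_nonempty_iff] at hemp
    exact h (iInf_of_empty _)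
  exact ENat.exists_eq_iInf _

theorem wdist_self (u : V) : wdist G ω u u = 0 := by
  simpa using wdist_le (ω := ω) (SimpleGraph.Walk.nil : G.Walk u u)

theorem wdist_comm (u v : V) : wdist G ω u v = wdist G ω v u := by
  have wdist_le_swap (u v : V) : wdist G ω u v ≤ wdist G ω v u :=
    le_iInf fun p => by simpa using wdist_le (ω := ω) p.reverse
  exact (wdist_le_swap u v).antisymm (wdist_le_swap v u)

theorem wdist_le_add {r u v : V} (h : G.Adj u v) :
    wdist G ω r v ≤ wdist G ω r u + (ω s(u, v) : ℕ) := by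
  by_cases ht : wdist G ω r u = ⊤
  · simp [ht]
  · obtain ⟨p, hp⟩ := exists_walk_of_wdist_ne_top ht
    rw [← hp]
    refine (wdist_le (p.concat h)).trans ?_
    simp [SimpleGraph.Walk.edges_concat]

theorem eq_or_exists_adj_wdist_add {r v : V} (h : wdist G ω r v ≠ ⊤) :
    r = v ∨ ∃ u, G.Adj u v ∧ wdist G ω r u + (ω s(u, v) : ℕ) = wdist G ω r v := by
  rw [wdist_comm] at h
  obtain ⟨p, hp⟩ := exists_walk_of_wdist_ne_top h
  cases p with
  | nil => exact Or.inl rfl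
  | @cons _ u _ hadj p =>
    refine Or.inr ⟨u, hadj.symm, le_antisymm ?_ (wdist_le_add hadj.symm)⟩
    calc wdist G ω r u + (ω s(u, v) : ℕ)
        ≤ ((p.edges.map ω).sum : ℕ) + (ω s(u, v) : ℕ) := by
          rw [wdist_comm]
          gcongr
          exact wdist_le p
      _ = wdist G ω r v := by
          rw [wdist_comm r v, ← hp, SimpleGraph.Walk.edges_cons, List.map_cons, List.sum_cons,
            Sym2.eq_swap, Nat.cast_add, add_comm]

theorem eq_of_wdist_eq_zero (hω : ∀ u v, G.Adj u v → 1 ≤ ω s(u, v)) {r v : V}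
    (h : wdist G ω r v = 0) : r = v := by
  rcases eq_or_exists_adj_wdist_add (h ▸ ENat.zero_ne_top) with h' | ⟨u, hu, h'⟩
  · exact h'
  · rw [h, add_eq_zero, Nat.cast_eq_zero] at h'
    exact absurd h'.2 (Nat.one_le_iff_ne_zero.mp (hω u v hu))

-- A shortest path has fewer edges than there are nodes.
theorem toNat_wdist_add_le [Fintype V] {W : ℕ} (hω : ∀ u v, G.Adj u v → ω s(u, v) ≤ W) {r v : V}
    (h : wdist G ω r v ≠ ⊤) : (wdist G ω r v).toNat + W ≤ Fintype.card V * W := by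
  classical
  obtain ⟨p, -⟩ := exists_walk_of_wdist_ne_top h
  have hweight : ∀ x ∈ p.toPath.1.edges.map ω, x ≤ W := by
    intro x hx
    obtain ⟨e, he, rfl⟩ := List.mem_map.mp hx
    have hedge := SimpleGraph.Walk.edges_subset_edgeSet _ he
    induction e using Sym2.ind with
    | _ a b => exact hω a b hedge
  calc (wdist G ω r v).toNat + W ≤ (p.toPath.1.edges.map ω).sum + W := by
        gcongr
        exact ENat.toNat_le_of_le_natCast (wdist_le p.toPath.1)
    _ ≤ p.toPath.1.length * W + W := by
        gcongr
        simpa using List.sum_le_card_nsmul _ W hweight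
    _ = (p.toPath.1.length + 1) * W := by ring
    _ ≤ Fintype.card V * W := by
        gcongr
        exact p.toPath.2.length_lt

end WeightedDistance

/-! ### The path that replaces an edge -/

section PathDistance

variable {V : Type*}

/-- The distances at position `j` on a path of length `w` between nodes with distances `d` and
`e`. -/
noncomputable def pathDist (d e : V → ℕ∞) (w j : ℕ) : V → ℕ∞ :=
  fun r => min (d r + j) (e r + (w - j : ℕ))

variable {d e : V → ℕ∞} {w j : ℕ} {r : V}

theorem pathDist_swap (d e : V → ℕ∞) (hj : j ≤ w) :
    pathDist d e w j = pathDist e d w (w - j) := by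
  funext r
  rw [pathDist, pathDist, min_comm, Nat.sub_sub_self hj]

theorem near_pathDist (d e : V → ℕ∞) (hj : j < w) :
    Near (pathDist d e w j) (pathDist d e w (j + 1)) := by
  obtain ⟨m, rfl⟩ := Nat.exists_eq_add_of_lt hj
  have hsub : j + m + 1 - j = m + 1 := by omega
  have hsub' : j + m + 1 - (j + 1) = m := by omega
  refine ⟨fun r => ?_, fun r => ?_⟩ <;>
    simp only [pathDist, Pi.add_apply, Pi.one_apply, hsub, hsub', Nat.cast_add, Nat.cast_one,
      ← add_assoc, ← min_add_add_right]
  · exact min_le_min (le_self_add.trans le_self_add) le_rfl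
  · exact min_le_min le_rfl (le_self_add.trans le_self_add)

theorem exists_pathDist_add_one_eq (d e : V → ℕ∞) (h0 : 0 < j) (hj : j < w) (r : V) :
    pathDist d e w (j - 1) r + 1 = pathDist d e w j r ∨
      pathDist d e w (j + 1) r + 1 = pathDist d e w j r := by
  obtain ⟨i, rfl⟩ := Nat.exists_eq_add_one.mpr h0
  obtain ⟨m, rfl⟩ := Nat.exists_eq_add_of_lt hj
  have hpred : i + 1 + m + 1 - i = m + 1 + 1 := by omega
  have hself : i + 1 + m + 1 - (i + 1) = m + 1 := by omega
  have hsucc : i + 1 + m + 1 - (i + 1 + 1) = m := by omega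
  simp only [Nat.add_sub_cancel i 1, pathDist, hpred, hself, hsucc, Nat.cast_add, Nat.cast_one,
    ← add_assoc, ← min_add_add_right]
  rcases le_total (d r + i) (e r + m) with hle | hle
  · left
    have hle' : d r + i + 1 ≤ e r + m + 1 := by gcongr
    rw [min_eq_left hle', min_eq_left (hle'.trans (le_self_add.trans le_self_add))]
  · right
    have hle' : e r + m + 1 ≤ d r + i + 1 := by gcongr
    rw [min_eq_right hle', min_eq_right (hle'.trans (le_self_add.trans le_self_add))]

theorem pathDist_ne_zero (d e : V → ℕ∞) (h0 : 0 < j) (hj : j < w) (r : V) :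
    pathDist d e w j r ≠ 0 := by
  simp [pathDist, ← nonpos_iff_eq_zero, h0, hj]

theorem pathDist_one_add_one_eq_iff (hw : 0 < w) (hr : d r ≠ ⊤) :
    pathDist d e w 1 r + 1 = d r ↔ e r + w = d r := by
  have hcast : ((w - 1 : ℕ) : ℕ∞) + 1 = w := by exact_mod_cast Nat.sub_add_cancel hw
  have hlt : d r < d r + 1 + 1 :=
    ((ENat.lt_add_one_iff hr).mpr le_rfl).trans_le le_self_add
  rw [pathDist, Nat.cast_one, ← min_add_add_right, add_assoc (e r), hcast]
  constructor
  · intro h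
    rcases min_choice (d r + 1 + 1) (e r + w) with hmin | hmin
    · exact absurd (hmin.symm.trans h) hlt.ne'
    · exact hmin.symm.trans h
  · intro h
    rw [h, min_eq_right hlt.le]

theorem pathDist_of_add_eq (h : d r + w = e r) (hj : j ≤ w) :
    pathDist d e w j r = d r + j := by
  rw [pathDist, ← h, add_assoc, ← Nat.cast_add]
  exact min_eq_left (by gcongr; omega)

/-- The distance functions of two nodes that are joined by an edge of weight `w`: they differ by at
most `w`. -/
def WeightedNear (d e : V → ℕ∞) (w : ℕ) : Prop := ∀ r, d r ≤ e r + w ∧ e r ≤ d r + w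

namespace WeightedNear

theorem pathDist_zero (h : WeightedNear d e w) : pathDist d e w 0 = d := by
  funext r
  simpa [pathDist] using (h r).1

theorem pathDist_self (h : WeightedNear d e w) : pathDist d e w w = e := by
  funext r
  simpa [pathDist] using (h r).2

theorem slot_le_slot_pathDist [LinearOrder V] [Fintype V] (h : WeightedNear d e w)
    (hr : d r ≠ ⊤) (he : d r + w = e r) (hj : j ≤ w) :
    slot d r ≤ slot (pathDist d e w j) r := by
  induction j with
  | zero => rw [h.pathDist_zero]
  | succ j ih =>
    refine (ih (Nat.le_of_succ_le hj)).trans (Nat.le_of_lt ?_)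
    refine slot_lt_slot_of_add_one_eq (near_pathDist d e hj).2 ?_ ?_
    · rw [pathDist_of_add_eq he (Nat.le_of_succ_le hj), pathDist_of_add_eq he hj, Nat.cast_add,
        Nat.cast_one, add_assoc]
    · rw [pathDist_of_add_eq he (Nat.le_of_succ_le hj)]
      exact WithTop.add_ne_top.mpr ⟨hr, ENat.natCast_ne_top j⟩

end WeightedNear

/-- The relay at position `j` of the path that replaces an edge of weight `w`. -/
noncomputable def relayNode (d e : V → ℕ∞) (h0 : 0 < j) (hj : j < w) : LocalDistances V Bool where
  links := [false, true]
  dist := pathDist d e w j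
  peer
    | false => pathDist d e w (j - 1)
    | true => pathDist d e w (j + 1)
  nodup := by simp
  near
    | false, _ => by
      simpa [Nat.sub_add_cancel h0] using (near_pathDist d e (j := j - 1) (by omega)).symm
    | true, _ => near_pathDist d e hj
  exists_parent r _ _ := by simpa using exists_pathDist_add_one_eq d e h0 hj r
  root_unique r _ hr := absurd hr (pathDist_ne_zero d e h0 hj r)

end PathDistance

/-! ### The relays on an edge -/

section Relays

variable {V : Type*} [LinearOrder V] [Fintype V] {d e : V → ℕ∞} {w k t : ℕ}
  {rel : ℕ → DLGState V Bool}

/-- The states of all relays on an edge at the beginning of round `t`. -/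
def RelaysInv (d e : V → ℕ∞) (w k t : ℕ) (rel : ℕ → DLGState V Bool) : Prop :=
  ∀ j (h0 : 0 < j) (hj : j < w), (relayNode d e h0 hj).RoundInv k t (rel j)

theorem relaysInv_idle : RelaysInv d e w k 0 fun _ => DLGState.idle :=
  fun _ h0 hj => LocalDistances.roundInv_idle (pathDist_ne_zero d e h0 hj)

namespace RelaysInv

theorem delivers_pred (hrel : RelaysInv d e w k t rel) {j : ℕ} (h0 : 0 < j) (hj : j < w) :
    Delivers (pathDist d e w (j - 1)) (pathDist d e w j) t ((rel j).outgoing false) :=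
  (hrel j h0 hj).delivers (i := false) (by simp [relayNode])

theorem delivers_succ (hrel : RelaysInv d e w k t rel) {j : ℕ} (h0 : 0 < j) (hj : j < w) :
    Delivers (pathDist d e w (j + 1)) (pathDist d e w j) t ((rel j).outgoing true) :=
  (hrel j h0 hj).delivers (i := true) (by simp [relayNode])

theorem delivers_left (hrel : RelaysInv d e w k t rel) (h : WeightedNear d e w) (hw : 1 < w) :
    Delivers d (pathDist d e w 1) t ((rel 1).outgoing false) := by
  simpa only [Nat.sub_self, h.pathDist_zero] using hrel.delivers_pred zero_lt_one hw

theorem delivers_right (hrel : RelaysInv d e w k t rel) (h : WeightedNear d e w) (hw : 1 < w) :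
    Delivers e (pathDist d e w (w - 1)) t ((rel (w - 1)).outgoing true) := by
  simpa only [Nat.sub_add_cancel hw.le, h.pathDist_self] using
    hrel.delivers_succ (j := w - 1) (by omega) (by omega)

theorem relayInbox_delivers (hrel : RelaysInv d e w k t rel) (h : WeightedNear d e w)
    {lo hi : Option (DLGMessage V)}
    (hlo : Delivers (pathDist d e w 1) d t lo) (hhi : Delivers (pathDist d e w (w - 1)) e t hi)
    {j : ℕ} (h0 : 0 < j) (hj : j < w) (i : Bool) :
    Delivers (relayNode d e h0 hj).dist ((relayNode d e h0 hj).peer i) t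
      (DLGcompState.relayInbox rel w lo hi j i) := by
  cases i <;> simp only [relayNode, DLGcompState.relayInbox] <;> split_ifs with hend
  · subst hend
    rwa [Nat.sub_self, h.pathDist_zero]
  · simpa only [Nat.sub_add_cancel h0] using
      hrel.delivers_succ (j := j - 1) (by omega) (by omega)
  · subst hend
    rwa [h.pathDist_self]
  · exact hrel.delivers_pred j.succ_pos (by omega)

theorem round (hrel : RelaysInv d e w k t rel) (h : WeightedNear d e w)
    {lo hi : Option (DLGMessage V)}
    (hlo : Delivers (pathDist d e w 1) d t lo) (hhi : Delivers (pathDist d e w (w - 1)) e t hi) :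
    RelaysInv d e w k (t + 1) fun j =>
      (rel j).round k t [false, true] (DLGcompState.relayInbox rel w lo hi j) :=
  fun j h0 hj => (hrel j h0 hj).round fun i _ => hrel.relayInbox_delivers h hlo hhi h0 hj i

end RelaysInv

end Relays

/-! ### The execution of DLGcomp -/

section Network

variable {V : Type*}

open Classical in
/-- The distances of a node from the roots; nodes outside `S` count as infinitely far away. -/
noncomputable def rootDist (G : SimpleGraph V) (ω : Sym2 V → ℕ) (S : Finset V) (u : V) : V → ℕ∞ :=
  fun r => if r ∈ S then wdist G ω r u else ⊤

/-- The distances of the relay, or neighbor, that is next to `u` on the edge to `v`. -/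
noncomputable def linkDist (G : SimpleGraph V) (ω : Sym2 V → ℕ) (S : Finset V) (u v : V) :
    V → ℕ∞ :=
  pathDist (rootDist G ω S u) (rootDist G ω S v) (ω s(u, v)) 1

variable {G : SimpleGraph V} {ω : Sym2 V → ℕ} {S : Finset V} {u v r : V} {k t : ℕ}

theorem mem_of_rootDist_ne_top (h : rootDist G ω S u r ≠ ⊤) : r ∈ S := by
  by_contra hr
  exact h (if_neg hr)

theorem rootDist_of_mem (h : r ∈ S) : rootDist G ω S u r = wdist G ω r u :=
  if_pos h

theorem rootDist_eq_zero_iff (hω : ∀ u v, G.Adj u v → 1 ≤ ω s(u, v)) :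
    rootDist G ω S u r = 0 ↔ r ∈ S ∧ r = u := by
  constructor
  · intro h
    have hr : r ∈ S := mem_of_rootDist_ne_top (h ▸ ENat.zero_ne_top)
    exact ⟨hr, eq_of_wdist_eq_zero hω (rootDist_of_mem hr ▸ h)⟩
  · rintro ⟨hr, rfl⟩
    rw [rootDist_of_mem hr, wdist_self]

theorem weightedNear_rootDist (S : Finset V) (h : G.Adj u v) :
    WeightedNear (rootDist G ω S u) (rootDist G ω S v) (ω s(u, v)) := by
  intro r
  by_cases hr : r ∈ S
  · rw [rootDist_of_mem hr, rootDist_of_mem hr]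
    exact ⟨by rw [Sym2.eq_swap]; exact wdist_le_add h.symm, wdist_le_add h⟩
  · simp [rootDist, hr]

theorem near_linkDist (hω : ∀ u v, G.Adj u v → 1 ≤ ω s(u, v)) (h : G.Adj u v) :
    Near (rootDist G ω S u) (linkDist G ω S u v) := by
  have hlink := near_pathDist (rootDist G ω S u) (rootDist G ω S v) (hω u v h)
  rwa [(weightedNear_rootDist S h).pathDist_zero] at hlink

theorem linkDist_add_one_eq_iff (hω : ∀ u v, G.Adj u v → 1 ≤ ω s(u, v)) (h : G.Adj u v)
    (hr : rootDist G ω S u r ≠ ⊤) :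
    linkDist G ω S u v r + 1 = rootDist G ω S u r ↔
      rootDist G ω S v r + (ω s(u, v) : ℕ) = rootDist G ω S u r :=
  pathDist_one_add_one_eq_iff (hω u v h) hr

theorem linkDist_swap (hω : ∀ u v, G.Adj u v → 1 ≤ ω s(u, v)) (h : G.Adj u v) :
    linkDist G ω S v u =
      pathDist (rootDist G ω S u) (rootDist G ω S v) (ω s(u, v)) (ω s(u, v) - 1) := by
  rw [linkDist, Sym2.eq_swap, pathDist_swap _ _ (hω u v h)]

theorem exists_adj_linkDist_add_one_eq (hω : ∀ u v, G.Adj u v → 1 ≤ ω s(u, v))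
    (hr : rootDist G ω S u r ≠ ⊤) (h0 : rootDist G ω S u r ≠ 0) :
    ∃ v, G.Adj u v ∧ linkDist G ω S u v r + 1 = rootDist G ω S u r := by
  have hS := mem_of_rootDist_ne_top hr
  rcases eq_or_exists_adj_wdist_add (rootDist_of_mem hS ▸ hr) with rfl | ⟨v, hv, hdist⟩
  · exact absurd ((rootDist_eq_zero_iff hω).mpr ⟨hS, rfl⟩) h0
  · refine ⟨v, hv.symm, (linkDist_add_one_eq_iff hω hv.symm hr).mpr ?_⟩
    rwa [rootDist_of_mem hS, rootDist_of_mem hS, Sym2.eq_swap]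

theorem directedLeveledGraph_arc_iff (hω : ∀ u v, G.Adj u v → 1 ≤ ω s(u, v)) (hr : r ∈ S) :
    (directedLeveledGraph G ω k r).arc u v ↔
      G.Adj v u ∧ linkDist G ω S v u r + 1 = rootDist G ω S v r ∧ rootDist G ω S v r ≤ k := by
  constructor
  · rintro ⟨hadj, i, hu, hk, hv⟩
    rw [← rootDist_of_mem hr] at hu hv
    refine ⟨hadj.symm, (linkDist_add_one_eq_iff hω hadj.symm ?_).mpr ?_, ?_⟩
    · exact hv ▸ ENat.natCast_ne_top _
    · rw [hu, hv, Sym2.eq_swap, Nat.cast_add]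
    · exact hv ▸ Nat.cast_le.mpr hk
  · rintro ⟨hadj, hdist, hk⟩
    have hv := ne_top_of_le_ne_top (ENat.natCast_ne_top k) hk
    rw [linkDist_add_one_eq_iff hω hadj hv, Sym2.eq_swap] at hdist
    have hu : rootDist G ω S u r ≠ ⊤ := ne_top_of_le_ne_top hv (hdist ▸ le_self_add)
    obtain ⟨i, hi⟩ := ENat.ne_top_iff_exists.mp hu
    rw [← hdist, ← hi, ← Nat.cast_add, Nat.cast_le] at hk
    rw [← hi, rootDist_of_mem hr, ← Nat.cast_add] at hdist
    exact ⟨hadj.symm, i, hi.symm ▸ (rootDist_of_mem hr).symm, hk, hdist.symm⟩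

variable [LinearOrder V] [Fintype V]

/-- The round in which DLGcomp delivers `r` over the edge from a parent `h` to `u`. -/
noncomputable def arrivalTime (G : SimpleGraph V) (ω : Sym2 V → ℕ) (S : Finset V) (h u : V) :
    V → ℕ :=
  linkSlot (rootDist G ω S u) (linkDist G ω S u h)

theorem arrivalTime_le (hω : ∀ u v, G.Adj u v → 1 ≤ ω s(u, v)) (h : G.Adj v u)
    (hk : rootDist G ω S v r ≤ k) : arrivalTime G ω S u v r ≤ S.card + k := by
  have hmem (s : V) (hs : (rootDist G ω S v ⊓ linkDist G ω S v u) s ≠ ⊤) : s ∈ S :=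
    mem_of_rootDist_ne_top ((near_linkDist hω h).ne_top_of_inf hs)
  calc arrivalTime G ω S u v r
      ≤ ((rootDist G ω S v ⊓ linkDist G ω S v u) r).toNat + S.card := slot_le hmem r
    _ ≤ k + S.card := by
        gcongr
        exact ENat.toNat_le_of_le_natCast (inf_le_left.trans hk)
    _ = S.card + k := add_comm _ _

theorem arrivalTime_injOn (hω : ∀ u v, G.Adj u v → 1 ≤ ω s(u, v)) (S : Finset V) (k : ℕ)
    (u v : V) :
    Set.InjOn (arrivalTime G ω S u v) {r | r ∈ S ∧ (directedLeveledGraph G ω k r).arc u v} :=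
  (linkSlot_injOn _ _).mono fun _ ⟨hr, harc⟩ =>
    ne_top_of_le_ne_top (ENat.natCast_ne_top k) ((directedLeveledGraph_arc_iff hω hr).mp harc).2.2

theorem arrivalTime_lt (hω : ∀ u v, G.Adj u v → 1 ≤ ω s(u, v)) {h c : V}
    (hr : r ∈ S) (hu : (directedLeveledGraph G ω k r).arc h u)
    (hc : (directedLeveledGraph G ω k r).arc u c) :
    arrivalTime G ω S h u r < arrivalTime G ω S u c r := by
  obtain ⟨hadj, hdist, hk⟩ := (directedLeveledGraph_arc_iff hω hr).mp hu
  obtain ⟨hadj', hdist', hk'⟩ := (directedLeveledGraph_arc_iff hω hr).mp hc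
  have hu' := ne_top_of_le_ne_top (ENat.natCast_ne_top k) hk
  have hc' := ne_top_of_le_ne_top (ENat.natCast_ne_top k) hk'
  have hweight := (linkDist_add_one_eq_iff hω hadj' hc').mp hdist'
  rw [Sym2.eq_swap] at hweight
  calc arrivalTime G ω S h u r < slot (rootDist G ω S u) r :=
        (near_linkDist hω hadj).linkSlot_lt_slot hdist hu'
    _ ≤ slot (linkDist G ω S c u) r := by
        rw [linkDist_swap hω hadj'.symm]
        exact (weightedNear_rootDist S hadj'.symm).slot_le_slot_pathDist hu' hweight
          (Nat.sub_le _ _)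
    _ ≤ linkSlot (linkDist G ω S c u) (rootDist G ω S c) r :=
        slot_le_linkSlot (le_self_add.trans_eq hdist')
    _ = arrivalTime G ω S u c r := by rw [linkSlot_comm, arrivalTime]

variable [DecidableRel G.Adj]

/-- The node `u` of the network. -/
noncomputable def networkNode (hω : ∀ u v, G.Adj u v → 1 ≤ ω s(u, v)) (S : Finset V) (u : V) :
    LocalDistances V V where
  links := (G.neighborFinset u).sort (· ≤ ·)
  dist := rootDist G ω S u
  peer := linkDist G ω S u
  nodup := Finset.sort_nodup _ _
  near v hv := near_linkDist hω (by simpa using hv)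
  exists_parent r hr h0 := by simpa using exists_adj_linkDist_add_one_eq hω hr h0
  root_unique r s hr hs :=
    ((rootDist_eq_zero_iff hω).mp hr).2.trans ((rootDist_eq_zero_iff hω).mp hs).2.symm

theorem mem_networkNode_links {hω : ∀ u v, G.Adj u v → 1 ≤ ω s(u, v)} :
    v ∈ (networkNode hω S u).links ↔ G.Adj u v := by
  simp [networkNode]

/-- The states of all nodes at the beginning of round `t`; both ends of an edge hold a copy of the
states of its relays. -/
structure NetworkInv (hω : ∀ u v, G.Adj u v → 1 ≤ ω s(u, v)) (S : Finset V) (k t : ℕ)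
    (st : V → DLGcompState V) : Prop where
  core : ∀ u, (networkNode hω S u).RoundInv k t (st u).core
  relay_lower : ∀ u v, G.Adj u v → u < v →
    RelaysInv (rootDist G ω S u) (rootDist G ω S v) (ω s(u, v)) k t ((st u).relay v)
  relay_upper : ∀ u v, G.Adj u v → u < v →
    RelaysInv (rootDist G ω S u) (rootDist G ω S v) (ω s(u, v)) k t ((st v).relay u)

theorem networkInv_start (hω : ∀ u v, G.Adj u v → 1 ≤ ω s(u, v)) (S : Finset V) (k : ℕ) :
    NetworkInv hω S k 0 fun u => (DLGcomp V).start (localView G ω S k u) where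
  core u := by
    simp only [DLGcomp, localView, decide_eq_true_eq]
    split_ifs with hu
    · refine LocalDistances.roundInv_root fun r => (rootDist_eq_zero_iff hω).trans ?_
      exact and_iff_right_of_imp fun h => h ▸ hu
    · refine LocalDistances.roundInv_idle fun r hr => hu ?_
      obtain ⟨hS, rfl⟩ := (rootDist_eq_zero_iff hω).mp hr
      exact hS
  relay_lower _ _ _ _ := relaysInv_idle
  relay_upper _ _ _ _ := relaysInv_idle

namespace NetworkInv

variable {hω : ∀ u v, G.Adj u v → 1 ≤ ω s(u, v)} {st : V → DLGcompState V}

theorem delivers (h : NetworkInv hω S k t st) (huv : G.Adj u v) :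
    Delivers (linkDist G ω S u v) (rootDist G ω S u) t ((st u).core.outgoing v) :=
  (h.core u).delivers (mem_networkNode_links.mpr huv)

theorem delivers_swap (h : NetworkInv hω S k t st) (huv : G.Adj u v) :
    Delivers (pathDist (rootDist G ω S u) (rootDist G ω S v) (ω s(u, v)) (ω s(u, v) - 1))
      (rootDist G ω S v) t ((st v).core.outgoing u) :=
  linkDist_swap hω huv ▸ h.delivers huv.symm

theorem coreInbox_delivers (h : NetworkInv hω S k t st) (huv : G.Adj u v) :
    Delivers (rootDist G ω S u) (linkDist G ω S u v) t
      (DLGcompState.coreInbox u v (ω s(u, v)) ((st u).relay v) ((st v).core.outgoing u)) := by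
  have hnear := weightedNear_rootDist (ω := ω) S huv
  rw [DLGcompState.coreInbox]
  split_ifs with hw huv'
  · have hw : ω s(u, v) = 1 := le_antisymm hw (hω u v huv)
    have hlink : linkDist G ω S u v = rootDist G ω S v := by
      simpa only [hw, linkDist] using hnear.pathDist_self
    have hdel := h.delivers_swap huv
    rwa [hw, Nat.sub_self, ← hw, hnear.pathDist_zero, ← hlink] at hdel
  · exact (h.relay_lower u v huv huv').delivers_left hnear (not_le.mp hw)
  · have hvu : v < u := (not_lt.mp huv').lt_of_ne huv.ne'
    rw [Sym2.eq_swap, linkDist_swap hω huv.symm]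
    exact (h.relay_upper v u huv.symm hvu).delivers_right (weightedNear_rootDist S huv.symm)
      (Sym2.eq_swap ▸ not_le.mp hw)

theorem step (h : NetworkInv hω S k t st) {inbox : V → V → List (DLGMessage V)}
    (hin : ∀ u v, G.Adj u v → (inbox u v).head? = (st v).core.outgoing u) :
    NetworkInv hω S k (t + 1) fun u =>
      (DLGcomp V).recv (localView G ω S k u) t (st u) (inbox u) where
  core u := by
    refine (h.core u).round fun v hv => ?_
    have huv := mem_networkNode_links.mp hv
    simp only [hin u v huv, localView, if_pos huv]
    exact h.coreInbox_delivers huv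
  relay_lower u v huv hlt := by
    simp only [DLGcomp, localView, hin u v huv, if_pos huv, if_pos hlt]
    exact (h.relay_lower u v huv hlt).round (weightedNear_rootDist S huv) (h.delivers huv)
      (h.delivers_swap huv)
  relay_upper u v huv hlt := by
    simp only [DLGcomp, localView, hin v u huv.symm, if_pos huv.symm, if_neg hlt.not_gt,
      Sym2.eq_swap (a := v)]
    exact (h.relay_upper u v huv hlt).round (weightedNear_rootDist S huv) (h.delivers huv)
      (h.delivers_swap huv)

end NetworkInv

theorem networkInv_stateAt (hω : ∀ u v, G.Adj u v → 1 ≤ ω s(u, v)) (S : Finset V) (k t : ℕ) :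
    NetworkInv hω S k t ((DLGcomp V).stateAt G (localView G ω S k) t) := by
  induction t with
  | zero => exact networkInv_start hω S k
  | succ t ih =>
    refine ih.step fun u v huv => ?_
    rw [if_pos huv.symm]
    exact Option.head?_toList

/-! ### The leveled graphs stored by DLGcomp -/

theorem networkInv_final (hω : ∀ u v, G.Adj u v → 1 ≤ ω s(u, v)) (S : Finset V) (k : ℕ) :
    NetworkInv hω S k (S.card + k + 1) ((DLGcomp V).final G (localView G ω S k)) :=
  networkInv_stateAt hω S k (S.card + k + 1)

theorem mem_parents_final_iff (hω : ∀ u v, G.Adj u v → 1 ≤ ω s(u, v)) {τ : ℕ} :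
    (u, τ) ∈ ((DLGcomp V).final G (localView G ω S k) v).core.parents r ↔
      r ∈ S ∧ (directedLeveledGraph G ω k r).arc u v ∧ τ = arrivalTime G ω S u v r := by
  rw [((networkInv_final hω S k).core v).mem_parents]
  constructor
  · rintro ⟨⟨hmem, hdist, hne⟩, hk, hτ, -⟩
    have hr := mem_of_rootDist_ne_top hne
    have hadj := mem_networkNode_links.mp hmem
    exact ⟨hr, (directedLeveledGraph_arc_iff hω hr).mpr ⟨hadj, hdist, hk⟩, hτ⟩
  · rintro ⟨hr, harc, hτ⟩
    obtain ⟨hadj, hdist, hk⟩ := (directedLeveledGraph_arc_iff hω hr).mp harc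
    have hne := ne_top_of_le_ne_top (ENat.natCast_ne_top k) hk
    exact ⟨⟨mem_networkNode_links.mpr hadj, hdist, hne⟩, hk, hτ,
      Nat.lt_succ_of_le (hτ ▸ arrivalTime_le hω hadj hk)⟩

theorem mem_L_final (hω : ∀ u v, G.Adj u v → 1 ≤ ω s(u, v)) (h : rootDist G ω S u r ≤ k) :
    r ∈ ((DLGcomp V).final G (localView G ω S k) u).core.L := by
  rw [((networkInv_final hω S k).core u).mem_L]
  by_cases h0 : rootDist G ω S u r = 0
  · exact Or.inl h0
  · have hne := ne_top_of_le_ne_top (ENat.natCast_ne_top k) h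
    obtain ⟨v, hadj, hdist⟩ := exists_adj_linkDist_add_one_eq hω hne h0
    exact Or.inr ⟨v, ⟨mem_networkNode_links.mpr hadj, hdist, hne⟩,
      Nat.lt_succ_of_le (arrivalTime_le hω hadj h)⟩

theorem storedLeveledGraph_final (hω : ∀ u v, G.Adj u v → 1 ≤ ω s(u, v)) (hr : r ∈ S) :
    storedLeveledGraph k ((DLGcomp V).final G (localView G ω S k)) r =
      directedLeveledGraph G ω k r := by
  ext i v
  · refine and_congr_right fun hi => ?_
    rw [((networkInv_final hω S k).core v).dist_eq, ← rootDist_of_mem hr]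
    split_ifs with hL
    · rfl
    · refine iff_of_false (ENat.top_ne_natCast i) fun hdist => hL (mem_L_final hω ?_)
      exact hdist.trans_le (Nat.cast_le.mpr hi)
  · simp [storedLeveledGraph, mem_parents_final_iff hω, hr]

end Network

/-! ### The execution of DLGagr -/

theorem flatMap_eq_of_forall_ne {α β : Type*} {l : List α} (hl : l.Nodup) {f : α → List β} {a : α}
    (ha : a ∈ l) (hf : ∀ b ≠ a, f b = []) : l.flatMap f = f a := by
  obtain ⟨l₁, l₂, rfl⟩ := List.append_of_mem ha
  obtain ⟨hnotMem, -⟩ := List.nodup_cons.mp (List.nodup_middle.mp hl)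
  have hnil (l' : List α) (h : a ∉ l') : l'.flatMap f = [] :=
    List.flatMap_eq_nil_iff.mpr fun b hb => hf b (ne_of_mem_of_not_mem hb h)
  rw [List.mem_append, not_or] at hnotMem
  rw [List.flatMap_append, List.flatMap_cons, hnil l₁ hnotMem.1, hnil l₂ hnotMem.2,
    List.nil_append, List.append_nil]

section Aggregation

variable {V β M : Type*} [LinearOrder V] [Fintype V] {G : SimpleGraph V} {ω : Sym2 V → ℕ}
  {S : Finset V} {k t t' : ℕ} {u v r s : V} {agg : Aggregator V β M}

/-- In round `t` of DLGagr the node `v` sends its message for the root `r` to its parent `u`: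
DLGagr runs through the arrival times of DLGcomp backwards. -/
structure SendsAt (G : SimpleGraph V) (ω : Sym2 V → ℕ) (S : Finset V) (k t : ℕ) (u v r : V) :
    Prop where
  mem : r ∈ S
  arc : (directedLeveledGraph G ω k r).arc u v
  time : t + arrivalTime G ω S u v r = S.card + k

theorem SendsAt.unique (hω : ∀ u v, G.Adj u v → 1 ≤ ω s(u, v)) (hr : SendsAt G ω S k t u v r)
    (hs : SendsAt G ω S k t u v s) : r = s :=
  arrivalTime_injOn hω S k u v ⟨hr.mem, hr.arc⟩ ⟨hs.mem, hs.arc⟩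
    (Nat.add_left_cancel (hr.time.trans hs.time.symm))

theorem exists_sendsAt_of_arc (hω : ∀ u v, G.Adj u v → 1 ≤ ω s(u, v)) (hr : r ∈ S)
    (h : (directedLeveledGraph G ω k r).arc u v) :
    ∃ t < S.card + k + 1, SendsAt G ω S k t u v r := by
  have hle := arrivalTime_le hω h.1.symm ((directedLeveledGraph_arc_iff hω hr).mp h).2.2
  exact ⟨S.card + k - arrivalTime G ω S u v r, by omega, hr, h, Nat.sub_add_cancel hle⟩

variable [DecidableRel G.Adj]

/-- The inputs of DLGagr that are left by DLGcomp. -/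
def aggregationInput (G : SimpleGraph V) [DecidableRel G.Adj] (ω : Sym2 V → ℕ) (S : Finset V)
    (k : ℕ) (u : V) : DLGagrInput V :=
  ⟨localView G ω S k u, (DLGcomp V).final G (localView G ω S k) u⟩

theorem filter_parents_eq_singleton (hω : ∀ u v, G.Adj u v → 1 ≤ ω s(u, v))
    (h : SendsAt G ω S k t u v r) :
    (((DLGcomp V).final G (localView G ω S k) v).core.parents r).filter
      (fun p => decide (p.1 = u ∧ t + p.2 = S.card + k)) = [(u, arrivalTime G ω S u v r)] := by
  set parents := ((DLGcomp V).final G (localView G ω S k) v).core.parents r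
  have hmem : (u, arrivalTime G ω S u v r) ∈ parents :=
    (mem_parents_final_iff hω).mpr ⟨h.mem, h.arc, rfl⟩
  calc parents.filter (fun p => decide (p.1 = u ∧ t + p.2 = S.card + k))
      = parents.filter (fun p => decide (p = (u, arrivalTime G ω S u v r))) := by
        refine List.filter_congr fun ⟨x, τ⟩ _ => decide_eq_decide.mpr ?_
        rw [Prod.mk.injEq, ← h.time, add_right_inj]
    _ = [(u, arrivalTime G ω S u v r)] := by
        rw [List.filter_eq, List.count_eq_one_of_mem
          (((networkInv_final hω S k).core v).nodup_parents r) hmem, List.replicate_one]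

theorem filter_parents_eq_nil (hω : ∀ u v, G.Adj u v → 1 ≤ ω s(u, v))
    (h : ¬ SendsAt G ω S k t u v r) :
    (((DLGcomp V).final G (localView G ω S k) v).core.parents r).filter
      (fun p => decide (p.1 = u ∧ t + p.2 = S.card + k)) = [] := by
  simp only [List.filter_eq_nil_iff, decide_eq_true_eq]
  rintro ⟨x, τ⟩ hx ⟨rfl, ht⟩
  obtain ⟨hr, harc, rfl⟩ := (mem_parents_final_iff hω).mp hx
  exact h ⟨hr, harc, ht⟩

theorem send_eq_singleton (hω : ∀ u v, G.Adj u v → 1 ≤ ω s(u, v)) (h : SendsAt G ω S k t u v r)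
    (val : V → β) :
    (DLGagr agg).send (aggregationInput G ω S k v) t val u = [(r, agg.out v r (val r))] := by
  have hL : r ∈ ((DLGcomp V).final G (localView G ω S k) v).core.L :=
    mem_L_final hω ((directedLeveledGraph_arc_iff hω h.mem).mp h.arc).2.2
  refine (flatMap_eq_of_forall_ne (Finset.sort_nodup _ _) ((Finset.mem_sort _).mpr hL)
    fun s hs => ?_).trans (congrArg (List.map _) (filter_parents_eq_singleton hω h))
  exact congrArg (List.map _) (filter_parents_eq_nil hω fun h' => hs (h'.unique hω h))

theorem send_eq_nil (hω : ∀ u v, G.Adj u v → 1 ≤ ω s(u, v)) (h : ∀ r, ¬ SendsAt G ω S k t u v r)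
    (val : V → β) : (DLGagr agg).send (aggregationInput G ω S k v) t val u = [] :=
  List.flatMap_eq_nil_iff.mpr fun r _ => congrArg (List.map _) (filter_parents_eq_nil hω (h r))

open Classical in
/-- The children from which a node receives a message for the root `r` in round `t`. -/
noncomputable def sendingChildren (G : SimpleGraph V) [DecidableRel G.Adj] (ω : Sym2 V → ℕ)
    (S : Finset V) (k : ℕ) (u r : V) (t : ℕ) : List V :=
  ((G.neighborFinset u).sort (· ≤ ·)).filter fun v => SendsAt G ω S k t u v r

theorem mem_sendingChildren : v ∈ sendingChildren G ω S k u r t ↔ SendsAt G ω S k t u v r := by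
  simpa [sendingChildren] using fun h : SendsAt G ω S k t u v r => h.arc.1

open Classical in
theorem foldl_inbox_apply (hω : ∀ u v, G.Adj u v → 1 ≤ ω s(u, v)) (sent val : V → β) :
    ((if G.Adj v u then (DLGagr agg).send (aggregationInput G ω S k v) t sent u else []).foldl
      (fun val' m => Function.update val' m.1 (agg.step u m.1 v m.2 (val' m.1))) val) r =
      if SendsAt G ω S k t u v r then agg.step u r v (agg.out v r (sent r)) (val r) else val r := by
  by_cases hsends : ∃ s, SendsAt G ω S k t u v s
  · obtain ⟨s, hs⟩ := hsends
    rw [if_pos hs.arc.1.symm, send_eq_singleton hω hs, List.foldl_cons, List.foldl_nil]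
    by_cases hrs : r = s
    · subst hrs
      rw [Function.update_self, if_pos hs]
    · rw [Function.update_of_ne hrs, if_neg fun h => hrs (h.unique hω hs)]
  · rw [send_eq_nil hω (not_exists.mp hsends), ite_self, List.foldl_nil,
      if_neg (not_exists.mp hsends r)]

theorem stateAt_succ (hω : ∀ u v, G.Adj u v → 1 ≤ ω s(u, v)) (t : ℕ) (u r : V) :
    (DLGagr agg).stateAt G (aggregationInput G ω S k) (t + 1) u r =
      (sendingChildren G ω S k u r t).foldl (fun b c => agg.step u r c (agg.out c r
        ((DLGagr agg).stateAt G (aggregationInput G ω S k) t c r)) b)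
        ((DLGagr agg).stateAt G (aggregationInput G ω S k) t u r) := by
  classical
  rw [sendingChildren, List.foldl_filter]
  simp only [decide_eq_true_eq]
  exact (List.foldl_hom (fun val : V → β => val r) fun val v =>
    (foldl_inbox_apply hω _ val).symm).symm

theorem stateAt_eq_of_no_message (hω : ∀ u v, G.Adj u v → 1 ≤ ω s(u, v))
    (h : ∀ t' ≥ t, ∀ c, ¬ SendsAt G ω S k t' u c r) (ht : t ≤ t') :
    (DLGagr agg).stateAt G (aggregationInput G ω S k) t' u r =
      (DLGagr agg).stateAt G (aggregationInput G ω S k) t u r := by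
  induction t', ht using Nat.le_induction with
  | base => rfl
  | succ t' ht ih =>
    have hnil : sendingChildren G ω S k u r t' = [] :=
      List.eq_nil_iff_forall_not_mem.mpr fun c hc => h t' ht c (mem_sendingChildren.mp hc)
    rw [stateAt_succ hω, hnil, List.foldl_nil, ih]

-- Arrival times increase along arcs, so all messages of the children come in before `t`.
theorem SendsAt.stateAt_eq_final (hω : ∀ u v, G.Adj u v → 1 ≤ ω s(u, v))
    (h : SendsAt G ω S k t u v r) :
    (DLGagr agg).stateAt G (aggregationInput G ω S k) t v r =
      (DLGagr agg).final G (aggregationInput G ω S k) v r := by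
  have ht : t ≤ S.card + k + 1 := by
    have := h.time
    omega
  refine (stateAt_eq_of_no_message hω (fun t' ht' c hc => ?_) ht).symm
  have hlt := arrivalTime_lt hω h.mem h.arc hc.arc
  have hsum := h.time.trans hc.time.symm
  omega

theorem stateAt_eq_foldl_final (hω : ∀ u v, G.Adj u v → 1 ≤ ω s(u, v)) (t : ℕ) (u r : V) :
    (DLGagr agg).stateAt G (aggregationInput G ω S k) t u r =
      ((List.range t).flatMap (sendingChildren G ω S k u r)).foldl
        (fun b c => agg.step u r c (agg.out c r
          ((DLGagr agg).final G (aggregationInput G ω S k) c r)) b) (agg.start u r) := by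
  induction t with
  | zero => rfl
  | succ t ih =>
    rw [stateAt_succ hω, List.range_succ, List.flatMap_append, List.foldl_append, ← ih,
      List.flatMap_singleton]
    refine List.foldl_ext _ _ _ fun b c hc => ?_
    rw [(mem_sendingChildren.mp hc).stateAt_eq_final hω]

theorem nodup_flatMap_sendingChildren (t : ℕ) (u r : V) :
    ((List.range t).flatMap (sendingChildren G ω S k u r)).Nodup := by
  refine List.nodup_flatMap.mpr
    ⟨fun _ _ => (Finset.sort_nodup _ _).filter _, List.nodup_range.imp fun hne c h h' => hne ?_⟩
  exact Nat.add_right_cancel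
    ((mem_sendingChildren.mp h).time.trans (mem_sendingChildren.mp h').time.symm)

theorem isBottomUpAggregate_final (hω : ∀ u v, G.Adj u v → 1 ≤ ω s(u, v)) (hr : r ∈ S) :
    IsBottomUpAggregate agg (directedLeveledGraph G ω k r) r
      (fun u => (DLGagr agg).final G (aggregationInput G ω S k) u r) := by
  refine fun u => ⟨(List.range (S.card + k + 1)).flatMap (sendingChildren G ω S k u r),
    nodup_flatMap_sendingChildren _ u r, fun c => ?_, stateAt_eq_foldl_final hω _ u r⟩
  simp only [List.mem_flatMap, List.mem_range, mem_sendingChildren]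
  exact ⟨fun ⟨_, _, h⟩ => h.arc, exists_sendsAt_of_arc hω hr⟩

end Aggregation

/-! ### Bandwidth -/

section Bandwidth

theorem size_le_of_le_pow {n c i : ℕ} (hn : 2 ≤ n) (h : i ≤ n ^ c) :
    i.size ≤ (2 * c + 1) * Nat.log 2 n := by
  have hlog : 1 ≤ Nat.log 2 n := Nat.log_pos one_lt_two hn
  have hlt : i < 2 ^ ((Nat.log 2 n + 1) * c + 1) := calc
    i ≤ n ^ c := h
    _ ≤ (2 ^ (Nat.log 2 n + 1)) ^ c := by
      gcongr
      exact (Nat.lt_pow_succ_log_self one_lt_two n).le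
    _ = 2 ^ ((Nat.log 2 n + 1) * c) := (pow_mul _ _ _).symm
    _ < 2 ^ ((Nat.log 2 n + 1) * c + 1) := Nat.pow_lt_pow_right one_lt_two (Nat.lt_succ_self _)
  calc i.size ≤ (Nat.log 2 n + 1) * c + 1 := Nat.size_le.mpr hlt
    _ ≤ (Nat.log 2 n + Nat.log 2 n) * c + Nat.log 2 n := by gcongr
    _ = (2 * c + 1) * Nat.log 2 n := by ring

theorem size_le_of_le_mul {n W i : ℕ} (hn : 2 ≤ n) (h : i ≤ n * W) :
    i.size ≤ 3 * (Nat.log 2 n + Nat.log 2 W) := by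
  have hlog : 1 ≤ Nat.log 2 n := Nat.log_pos one_lt_two hn
  have hlt : i < 2 ^ (Nat.log 2 n + 1 + (Nat.log 2 W + 1)) := by
    rw [pow_add]
    exact h.trans_lt (Nat.mul_lt_mul'' (Nat.lt_pow_succ_log_self one_lt_two n)
      (Nat.lt_pow_succ_log_self one_lt_two W))
  have hsize := Nat.size_le.mpr hlt
  omega

variable {V : Type*} [Fintype V] {G : SimpleGraph V} {u v : V}

theorem two_le_card_of_adj (h : G.Adj u v) : 2 ≤ Fintype.card V :=
  Fintype.one_lt_card_iff.mpr ⟨u, v, h.ne⟩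

variable [LinearOrder V] [DecidableRel G.Adj] {ω : Sym2 V → ℕ} {S : Finset V} {k c : ℕ}
  {ID : V → ℕ}

theorem DLGcomp_respectsBandwidth {W : ℕ} (hID : ∀ v, ID v ≤ Fintype.card V ^ c)
    (hω : ∀ u v, G.Adj u v → 1 ≤ ω s(u, v)) (hW : ∀ u v, G.Adj u v → ω s(u, v) ≤ W) :
    (DLGcomp V).RespectsBandwidth G (localView G ω S k) (fun m => Nat.size (ID m.1) + Nat.size m.2)
      ((2 * c + 4) * (Nat.log 2 (Fintype.card V) + Nat.log 2 W)) := by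
  refine fun u v huv t _ => ⟨Option.length_toList_le, fun ⟨r, x⟩ hm => ?_⟩
  obtain ⟨-, (hr : rootDist G ω S u r ≠ ⊤), rfl⟩ :=
    ((networkInv_stateAt hω S k t).core u).of_outgoing_eq_some
      (mem_networkNode_links.mpr huv) (Option.mem_toList.mp hm)
  have hcard := two_le_card_of_adj huv
  have hdist : (rootDist G ω S u r).toNat + 1 ≤ Fintype.card V * W := by
    have hS := mem_of_rootDist_ne_top hr
    rw [rootDist_of_mem hS] at hr ⊢
    have hW1 : 1 ≤ W := (hω u v huv).trans (hW u v huv)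
    exact (Nat.add_le_add_left hW1 _).trans (toNat_wdist_add_le hW hr)
  calc Nat.size (ID r) + Nat.size ((rootDist G ω S u r).toNat + 1)
      ≤ (2 * c + 1) * Nat.log 2 (Fintype.card V) +
          3 * (Nat.log 2 (Fintype.card V) + Nat.log 2 W) :=
        Nat.add_le_add (size_le_of_le_pow hcard (hID r)) (size_le_of_le_mul hcard hdist)
    _ ≤ (2 * c + 1) * (Nat.log 2 (Fintype.card V) + Nat.log 2 W) +
          3 * (Nat.log 2 (Fintype.card V) + Nat.log 2 W) := by
        gcongr
        exact Nat.le_add_right _ _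
    _ = (2 * c + 4) * (Nat.log 2 (Fintype.card V) + Nat.log 2 W) := by ring

theorem DLGagr_respectsBandwidth {β M : Type*} {agg : Aggregator V β M}
    (hID : ∀ v, ID v ≤ Fintype.card V ^ c) (hω : ∀ u v, G.Adj u v → 1 ≤ ω s(u, v))
    {size : M → ℕ} {b : ℕ} (hb : ∀ u, ∀ r ∈ S,
      size (agg.out u r ((DLGagr agg).final G (aggregationInput G ω S k) u r)) ≤ b) :
    (DLGagr agg).RespectsBandwidth G (aggregationInput G ω S k)
      (fun m => Nat.size (ID m.1) + size m.2)
      ((2 * c + 4) * Nat.log 2 (Fintype.card V) + b) := by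
  intro u v huv t _
  by_cases hsends : ∃ r, SendsAt G ω S k t v u r
  · obtain ⟨r, hr⟩ := hsends
    rw [send_eq_singleton hω hr]
    refine ⟨le_rfl, fun m hm => ?_⟩
    rw [List.mem_singleton.mp hm, hr.stateAt_eq_final hω]
    refine Nat.add_le_add ((size_le_of_le_pow (two_le_card_of_adj huv) (hID r)).trans ?_)
      (hb u r hr.mem)
    gcongr
    norm_num
  · rw [send_eq_nil hω (not_exists.mp hsends)]
    exact ⟨zero_le_one, fun _ hm => absurd hm List.not_mem_nil⟩

end Bandwidth

theorem theorem1 :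
    ∃ C : ℕ, ∀ c : ℕ, ∃ B : ℕ,
      ∀ (V : Type*) [Fintype V] [LinearOrder V] (ID : V ↪o ℕ)
        (G : SimpleGraph V) [DecidableRel G.Adj] (ω : Sym2 V → ℕ) (W : ℕ)
        (S : Finset V) (k : ℕ),
        (∀ v, ID v ≤ Fintype.card V ^ c) →
        (∀ u v, G.Adj u v → 1 ≤ ω s(u, v) ∧ ω s(u, v) ≤ W) →
        S.Nonempty →
        -- DLGcomp
        ((∀ u, (DLGcomp V).rounds (localView G ω S k u) ≤ C * (S.card + k)) ∧
          (DLGcomp V).RespectsBandwidth G (localView G ω S k)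
            (fun m => Nat.size (ID m.1) + Nat.size m.2)
            (B * (Nat.log 2 (Fintype.card V) + Nat.log 2 W)) ∧
          ∀ r ∈ S, storedLeveledGraph k ((DLGcomp V).final G (localView G ω S k)) r =
            directedLeveledGraph G ω k r) ∧
        -- DLGagr, run on the result of DLGcomp
        ∀ (β M : Type*) (agg : Aggregator V β M),
          let input : V → DLGagrInput V := fun u =>
            ⟨localView G ω S k u, (DLGcomp V).final G (localView G ω S k) u⟩
          let result : V → V → β := (DLGagr agg).final G input
          (∀ u, (DLGagr agg).rounds (input u) ≤ C * (S.card + k)) ∧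
          (∀ (size : M → ℕ) (b : ℕ), (∀ u, ∀ r ∈ S, size (agg.out u r (result u r)) ≤ b) →
            (DLGagr agg).RespectsBandwidth G input (fun m => Nat.size (ID m.1) + size m.2)
              (B * Nat.log 2 (Fintype.card V) + b)) ∧
          ∀ r ∈ S, IsBottomUpAggregate agg (directedLeveledGraph G ω k r) r
            (fun u => result u r) := by
  refine ⟨2, fun c => ⟨2 * c + 4, ?_⟩⟩
  intro V _ _ ID G _ ω W S k hID hωW hS
  have hω : ∀ u v, G.Adj u v → 1 ≤ ω s(u, v) := fun u v h => (hωW u v h).1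
  have hrounds : S.card + k + 1 ≤ 2 * (S.card + k) := by
    have := hS.card_pos
    omega
  refine ⟨⟨fun _ => hrounds, DLGcomp_respectsBandwidth hID hω fun u v h => (hωW u v h).2,
    fun r hr => storedLeveledGraph_final hω hr⟩, fun β M agg => ?_⟩
  exact ⟨fun _ => hrounds, fun size b hb => DLGagr_respectsBandwidth hID hω hb,
    fun r hr => isBottomUpAggregate_final hω hr⟩
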